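/- An oracle $A$ is a collection of Boolean functions $A_m:\{0,1\}^m\to\{0,1\}$, one for each $m\in\mathbb N$. Its multilinear extension $\widetilde A$ is the collection of functions $\widetilde A_{m,\mathbb F}:\mathbb F^m\to\mathbb F$, one for each $m$ and each finite field $\mathbb F$, where $\widetilde A_{m,\mathbb F}$ is the unique polynomial function of degree at most $1$ in every variable that agrees with $A_m$ on $\{0,1\}^m$. A machine or circuit with oracle $\widetilde A$ may query $\widetilde A_{m,\mathbb F}$ for any $m$ and $\mathbb F$ of its choice, where a query is a string of length $\Theta(m\log|\mathbb F|)$ (for $m\ge 1$) that names $\mathbb F$ as $\mathbb F_p[X]/(f)$ for a prime $p$ and a monic irreducible $f$ and lists the coordinates of the point; writing the query costs the machine one step per bit. Let $\mathsf{BPE}^{O}$ be the class of languages decided with two-sided error at most $1/3$ by probabilistic oracle Turing machines with oracle $O$ in time $2^{O(n)}$; let $\mathsf{SIZE}^{O}[O(n)]$ (respectively $\mathsf{P}^{O}/\mathrm{poly}$) be the class of languages that have $O$-oracle circuits of size $O(n)$ (respectively of polynomial size), counting gates and wires, on all input lengths $n$. **Theorem.** There is an oracle $A$ with multilinear extension $\widetilde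 A$ such that $$\mathsf{BPE}^{\widetilde A}\subseteq \mathsf{SIZE}^{A}[O(n)].$$ Consequently the separation $\mathsf{BPE}\not\subseteq\mathsf{P}/\mathrm{poly}$ does not algebrize, i.e. it is not true that $\mathsf{BPE}^{\widetilde A}\not\subseteq\mathsf{P}^{A}/\mathrm{poly}$ for every oracle $A$; and it does not affine relativize, i.e. it is not true that $\mathsf{BPE}^{\widetilde A}\not\subseteq\mathsf{P}^{\widetilde A}/\mathrm{poly}$ for every oracle $A$. -/

import Mathlib

/-! ### Oracles and their multilinear extensions -/

/-- An oracle: one Boolean function on `{0,1}^m` for every `m`. -/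
abbrev Oracle : Type := (m : ℕ) → (Fin m → Bool) → Bool

/-- The multilinear polynomial over `K` that extends `g : {0,1}^m → {0,1}`. -/
noncomputable def multilinearPoly (K : Type*) [CommRing K] {m : ℕ} (g : (Fin m → Bool) → Bool) :
    MvPolynomial (Fin m) K :=
  ∑ b : Fin m → Bool, if g b then
    ∏ i, (if b i then MvPolynomial.X i else 1 - MvPolynomial.X i) else 0

/-- The multilinear extension of the length-`m` part of the oracle `A`, as a function
`K^m → K`. -/
noncomputable def multilinearExt (A : Oracle) (m : ℕ) (K : Type*) [CommRing K]
    (x : Fin m → K) : K :=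
  MvPolynomial.eval x (multilinearPoly K (A m))

/-- The polynomial has degree at most one in every variable. -/
theorem multilinearPoly_degreeOf_le (K : Type*) [CommRing K] {m : ℕ}
    (g : (Fin m → Bool) → Bool) (j : Fin m) :
    (multilinearPoly K g).degreeOf j ≤ 1 := by
  classical
  refine (MvPolynomial.degreeOf_sum_le j _ _).trans (Finset.sup_le fun b _ => ?_)
  split_ifs
  · refine (MvPolynomial.degreeOf_prod_le j _ _).trans ?_
    have hX : ∀ i : Fin m,
        MvPolynomial.degreeOf j (MvPolynomial.X i : MvPolynomial (Fin m) K) ≤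
          if i = j then 1 else 0 := by
      intro i
      rcases subsingleton_or_nontrivial K with hK | hK
      · rw [Subsingleton.elim (MvPolynomial.X i : MvPolynomial (Fin m) K) 0]
        simp
      · rw [MvPolynomial.degreeOf_X]
        simp only [eq_comm]
        exact le_rfl
    have hone : MvPolynomial.degreeOf j (1 : MvPolynomial (Fin m) K) = 0 := by
      simp
    calc _ ≤ ∑ i : Fin m, (if i = j then 1 else 0) := by
          refine Finset.sum_le_sum fun i _ => ?_
          split_ifs with h1 h2 h2
          · simpa [h2] using hX i
          · simpa [h2] using hX i
          · refine (MvPolynomial.degreeOf_sub_le j _ _).trans ?_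
            simpa [h2, hone] using hX i
          · refine (MvPolynomial.degreeOf_sub_le j _ _).trans ?_
            simpa [h2, hone] using hX i
      _ ≤ 1 := by simp
  · simp

/-- The multilinear extension agrees with the oracle on `{0,1}^m`. -/
theorem multilinearExt_bool (A : Oracle) (m : ℕ) (K : Type*) [CommRing K] (b : Fin m → Bool) :
    multilinearExt A m K (fun i => if b i then 1 else 0) = if A m b then 1 else 0 := by
  classical
  unfold multilinearExt multilinearPoly
  rw [map_sum, Finset.sum_eq_single b]
  · split_ifs
    · rw [map_prod]
      refine Finset.prod_eq_one fun i _ => ?_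
      by_cases h : b i <;> simp [h]
    · simp
  · intro c _ hc
    obtain ⟨i, hi⟩ := Function.ne_iff.mp hc
    split_ifs
    · rw [map_prod]
      refine Finset.prod_eq_zero (Finset.mem_univ i) ?_
      cases h : b i <;> cases h' : c i <;> simp_all
    · simp
  · simp

/-- Over a field, a polynomial of degree at most one in every variable is determined by its values
on `{0,1}^m`. -/
theorem multilinear_unique (K : Type*) [Field K] {m : ℕ} (P R : MvPolynomial (Fin m) K)
    (hP : ∀ j, P.degreeOf j ≤ 1) (hR : ∀ j, R.degreeOf j ≤ 1)
    (h : ∀ b : Fin m → Bool, MvPolynomial.eval (fun i => if b i then 1 else 0) P =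
      MvPolynomial.eval (fun i => if b i then 1 else 0) R) : P = R := by
  classical
  rw [← sub_eq_zero]
  refine MvPolynomial.eq_zero_of_eval_zero_at_prod_finset (P - R) (fun _ => {0, 1}) ?_ ?_
  · intro i
    refine (MvPolynomial.degreeOf_sub_le i _ _).trans_lt ?_
    have := hP i
    have := hR i
    rw [Finset.card_pair zero_ne_one]
    omega
  · intro x hx
    have hx' : x = fun i => if decide (x i = 1) then 1 else 0 := by
      funext i
      have := hx i
      simp only [Finset.mem_insert, Finset.mem_singleton] at this
      rcases this with h | h <;> simp [h]
    rw [hx', map_sub, h, sub_self]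

/-! ### Oracles as answering bit strings -/

/-- What a machine or a circuit sees of an oracle: query strings are answered by strings. -/
abbrev StringOracle : Type := List Bool → List Bool

/-- A Boolean oracle answers a query `x ∈ {0,1}^m` by the single bit `A_m(x)`. -/
def Oracle.boolean (A : Oracle) : StringOracle :=
  fun q => [A q.length q.get]

/-- The number with little-endian binary digits `l`. -/
def natOfBits (l : List Bool) : ℕ := Nat.ofDigits 2 (l.map Bool.toNat)

/-- The `w` low-order binary digits of `n`, little-endian. -/
def bitsOfNat (w n : ℕ) : List Bool := List.ofFn fun i : Fin w => n.testBit i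

/-- A query to a multilinear extension: a number `p`, the coefficients
`f_0, …, f_{k-1}` of a monic polynomial of degree `k`, and `m` elements of `(ℤ/p)[X]/(f)`, each
given by `k` coefficients. -/
structure RawQuery where
  p : ℕ
  k : ℕ
  m : ℕ
  f : Fin k → ℕ
  x : Fin m → Fin k → ℕ

/-- A query is written as the string `1^w 0 ⟨p⟩ 1^k 0 1^m 0 ⟨f_0⟩ … ⟨f_{k-1}⟩ ⟨x_{0,0}⟩ … ⟨x_{m-1,k-1}⟩`,
where `w` is the binary length of `p` and every number takes exactly `w` bits. -/
def RawQuery.encode (Q : RawQuery) : List Bool :=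
  let w := Nat.size Q.p
  List.replicate w true ++ false :: (bitsOfNat w Q.p ++
    (List.replicate Q.k true ++ false :: (List.replicate Q.m true ++ false ::
      ((List.ofFn fun i => bitsOfNat w (Q.f i)).flatten ++
        (List.ofFn fun j => (List.ofFn fun i => bitsOfNat w (Q.x j i)).flatten).flatten))))

/-- The query with given `w`, `p`, `k`, `m` whose coefficients are read off the string `l`, which must
have exactly the right length. -/
def RawQuery.ofParts (w p k m : ℕ) (l : List Bool) : Option RawQuery :=
  let num : ℕ → ℕ := fun i => natOfBits ((l.drop (i * w)).take w)
  if Nat.size p = w ∧ l.length = (k + m * k) * w then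
    some ⟨p, k, m, fun i => num i, fun j i => num (k + j * k + i)⟩
  else none

/-- Reading a query string; strings that are not of the right shape are rejected. -/
def RawQuery.parse (l : List Bool) : Option RawQuery :=
  let w := (l.takeWhile id).length
  let l₁ := l.drop (w + 1)
  let l₂ := l₁.drop w
  let k := (l₂.takeWhile id).length
  let l₃ := l₂.drop (k + 1)
  let m := (l₃.takeWhile id).length
  RawQuery.ofParts w (natOfBits (l₁.take w)) k m (l₃.drop (m + 1))

theorem natOfBits_bitsOfNat (w n : ℕ) (h : n < 2 ^ w) : natOfBits (bitsOfNat w n) = n := by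
  unfold natOfBits bitsOfNat
  induction w generalizing n with
  | zero => simp at h; simp [h]
  | succ w ih =>
    have h2 : n / 2 < 2 ^ w := by rw [pow_succ] at h; omega
    have := ih (n / 2) h2
    simp only [List.ofFn_succ, List.map_cons, Nat.ofDigits_cons, Fin.val_zero, Fin.val_succ,
      Nat.testBit_succ, this]
    have h0 : (n.testBit 0).toNat = n % 2 := by
      rw [Nat.testBit_zero]; rcases Nat.mod_two_eq_zero_or_one n with h | h <;> simp [h]
    rw [h0]; omega

theorem length_bitsOfNat (w n : ℕ) : (bitsOfNat w n).length = w := by simp [bitsOfNat]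

theorem takeWhile_unary (w : ℕ) (l : List Bool) :
    (List.replicate w true ++ false :: l).takeWhile id = List.replicate w true := by
  induction w with
  | zero => simp
  | succ w ih => simp [List.replicate_succ, ih]

theorem drop_unary (w : ℕ) (l : List Bool) :
    (List.replicate w true ++ false :: l).drop (w + 1) = l := by
  rw [List.drop_append]; simp

theorem block_flatten {w n : ℕ} (g : Fin n → List Bool) (hg : ∀ i, (g i).length = w) (l : List Bool) (i : Fin n) :
   (((List.ofFn g).flatten ++ l).drop (i * w)).take w = g i := by
  induction n with
  | zero => exact i.elim0
  | succ n ih =>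
    rw [List.ofFn_succ, List.flatten_cons, List.append_assoc]
    refine Fin.cases ?_ (fun i => ?_) i
    · simp [← hg 0]
    · rw [Fin.val_succ, show ((i:ℕ)+1)*w = (g 0).length + i * w by rw [hg]; ring, List.drop_length_add_append]
      exact ih (fun i => g i.succ) (fun i => hg _) i

theorem length_flatten_ofFn {w n : ℕ} (g : Fin n → List Bool) (hg : ∀ i, (g i).length = w) : (List.ofFn g).flatten.length = n * w := by
  induction n with
  | zero => simp
  | succ n ih => rw [List.ofFn_succ, List.flatten_cons, List.length_append, hg, ih _ (fun i => hg _)]; ring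

/-- Every query can be asked: reading what was written gives the query back. -/
theorem RawQuery.parse_encode (Q : RawQuery) (hf : ∀ i, Q.f i < 2 ^ Nat.size Q.p)
    (hx : ∀ j i, Q.x j i < 2 ^ Nat.size Q.p) : RawQuery.parse Q.encode = some Q := by
  obtain ⟨p, k, m, f, x⟩ := Q
  simp only at hf hx
  have hp : p < 2 ^ Nat.size p := Nat.lt_size_self p
  have e1 : ∀ r : List Bool, (bitsOfNat (Nat.size p) p ++ r).take (Nat.size p) = bitsOfNat (Nat.size p) p := by
    intro r; simp [length_bitsOfNat]
  have e2 : ∀ r : List Bool, (bitsOfNat (Nat.size p) p ++ r).drop (Nat.size p) = r := by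
    intro r; simp [length_bitsOfNat]
  have l1 : (List.ofFn fun i => bitsOfNat p.size (f i)).flatten.length = k * p.size :=
    length_flatten_ofFn _ (fun i => length_bitsOfNat _ _)
  have l2 : ∀ j, (List.ofFn fun i => bitsOfNat p.size (x j i)).flatten.length = k * p.size :=
    fun j => length_flatten_ofFn _ (fun i => length_bitsOfNat _ _)
  have l3 := length_flatten_ofFn (fun j => (List.ofFn fun i => bitsOfNat p.size (x j i)).flatten) l2
  simp only [RawQuery.parse, RawQuery.encode, takeWhile_unary, drop_unary, List.length_replicate,
    e1, e2, natOfBits_bitsOfNat _ _ hp]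
  simp only [RawQuery.ofParts, List.length_append, l1, l3]
  rw [if_pos ⟨trivial, by ring⟩]
  congr 2
  · funext i
    rw [block_flatten _ (fun i => length_bitsOfNat _ _), natOfBits_bitsOfNat _ _ (hf i)]
  · funext j i
    have hh : ((k + j * k + i : ℕ)) * p.size = (List.ofFn fun i => bitsOfNat p.size (f i)).flatten.length + (j * (k * p.size) + i * p.size) := by
      rw [l1]; ring
    rw [hh, List.drop_length_add_append, ← List.drop_drop]
    have hb := block_flatten (fun j => (List.ofFn fun i => bitsOfNat p.size (x j i)).flatten) l2 [] j
    rw [List.append_nil] at hb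
    have hc := block_flatten (fun i => bitsOfNat p.size (x j i)) (fun i => length_bitsOfNat _ _) [] i
    rw [List.append_nil] at hc
    rw [← natOfBits_bitsOfNat _ _ (hx j i), ← hc, ← hb]
    congr 1
    rw [List.drop_take, List.take_take]
    congr 1
    have : ((i:ℕ) + 1) * p.size ≤ k * p.size := Nat.mul_le_mul_right _ i.2
    rw [add_mul] at this
    omega

/-- The monic polynomial `X^k + f_{k-1} X^{k-1} + ⋯ + f_0` over `ℤ/p`. -/
noncomputable def RawQuery.poly (Q : RawQuery) : Polynomial (ZMod Q.p) :=
  Polynomial.X ^ Q.k + ∑ i : Fin Q.k, Polynomial.C (Q.f i : ZMod Q.p) * Polynomial.X ^ (i : ℕ)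

theorem RawQuery.poly_monic (Q : RawQuery) : Q.poly.Monic :=
  Polynomial.monic_X_pow_add (Polynomial.degree_sum_fin_lt _)

/-- The `j`-th coordinate of the queried point, an element of `(ℤ/p)[X]/(f)`. -/
noncomputable def RawQuery.point (Q : RawQuery) (j : Fin Q.m) : AdjoinRoot Q.poly :=
  AdjoinRoot.mk Q.poly
    (∑ i : Fin Q.k, Polynomial.C (Q.x j i : ZMod Q.p) * Polynomial.X ^ (i : ℕ))

/-- The value of the multilinear extension of `A` at the queried point. -/
noncomputable def RawQuery.value (A : Oracle) (Q : RawQuery) : AdjoinRoot Q.poly :=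
  multilinearExt A Q.m (AdjoinRoot Q.poly) Q.point

/-- An element of `(ℤ/p)[X]/(f)` written down by the `k` coefficients of its reduced
representative, each with as many bits as `p` has. -/
noncomputable def RawQuery.encodeElement (Q : RawQuery) (v : AdjoinRoot Q.poly) : List Bool :=
  (List.ofFn fun i : Fin Q.k => bitsOfNat (Nat.size Q.p)
    ((AdjoinRoot.modByMonicHom Q.poly_monic v).coeff i).val).flatten

open Classical in
/-- The multilinear extension of `A` over all finite fields, as a string oracle.  A query names
a finite field by a prime `p` and a monic irreducible `f` over `ℤ/p`, and a point over this field;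
every other string is answered by the empty string. -/
noncomputable def Oracle.multilinear (A : Oracle) : StringOracle := fun q =>
  match RawQuery.parse q with
  | none => []
  | some Q => if Q.p.Prime ∧ Irreducible Q.poly then Q.encodeElement (Q.value A) else []

/-! ### Probabilistic oracle Turing machines -/

/-- A step does nothing with the oracle, appends a bit to the query, or asks the query. -/
inductive OracleOp : Type
  | idle
  | push (b : Bool)
  | ask

/-- What a machine with `s` states and `t` tapes does in one step: go to a state (`Sum.inl`) or halt
with a verdict (`Sum.inr`), write a symbol (`none` is the blank) on every tape, move every head (`none`
leaves it in place), and act on the oracle. -/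
structure TMAction (s t : ℕ) where
  next : Fin s ⊕ Bool
  write : Fin t → Option Bool
  move : Fin t → Option Turing.Dir
  op : OracleOp

/-- A probabilistic multitape oracle Turing machine.  Tape `0` holds the input at the start, tape `1`
receives the answers of the oracle, and there are `numWork` more tapes.  The transition function
sees the state, the scanned symbols and a fresh random bit. -/
structure OracleTM where
  numStates : ℕ
  numWork : ℕ
  start : Fin numStates
  trans : Fin numStates → (Fin (numWork + 2) → Option Bool) → Bool →
    TMAction numStates (numWork + 2)

namespace OracleTM

/-- A configuration: the state or the verdict, the tapes, and the query written so far. -/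
structure Cfg (M : OracleTM) where
  state : Fin M.numStates ⊕ Bool
  tape : Fin (M.numWork + 2) → Turing.Tape (Option Bool)
  query : List Bool

/-- The start configuration on input `x`. -/
def init (M : OracleTM) (x : List Bool) : M.Cfg where
  state := Sum.inl M.start
  tape := fun i => if i = 0 then Turing.Tape.mk₁ (x.map some) else Turing.Tape.mk₁ []
  query := []

/-- One step with oracle `O` and random bit `r`.  When a query is asked, the answer replaces the
contents of tape `1`, with the head on its first symbol, and the query is erased. -/
def step (M : OracleTM) (O : StringOracle) (c : M.Cfg) (r : Bool) : M.Cfg :=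
  match c.state with
  | Sum.inr _ => c
  | Sum.inl q =>
    let a := M.trans q (fun i => (c.tape i).head) r
    let tape' : Fin (M.numWork + 2) → Turing.Tape (Option Bool) := fun i =>
      match a.move i with
      | none => (c.tape i).write (a.write i)
      | some d => ((c.tape i).write (a.write i)).move d
    match a.op with
    | OracleOp.idle => ⟨a.next, tape', c.query⟩
    | OracleOp.push b => ⟨a.next, tape', c.query ++ [b]⟩
    | OracleOp.ask =>
      ⟨a.next, Function.update tape' 1 (Turing.Tape.mk₁ ((O c.query).map some)), []⟩

/-- The configuration after as many steps as there are random bits in `r`. -/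
def run (M : OracleTM) (O : StringOracle) (x r : List Bool) : M.Cfg :=
  r.foldl (M.step O) (M.init x)

/-- The probability, over `T` uniform random bits, that `M` has halted and accepted `x` after
`T` steps. -/
def acceptProb (M : OracleTM) (O : StringOracle) (x : List Bool) (T : ℕ) : ℚ :=
  (Finset.univ.filter fun r : Fin T → Bool =>
    (M.run O x (List.ofFn r)).state = Sum.inr true).card / 2 ^ T

/-- `M` with oracle `O` decides `L` with two-sided error `1/3`, halting within `T |x|` steps on every
input `x` and all random bits. -/
def DecidesBP (M : OracleTM) (O : StringOracle) (T : ℕ → ℕ) (L : Language Bool) : Prop :=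
  ∀ x : List Bool,
    (∀ r : Fin (T x.length) → Bool, (M.run O x (List.ofFn r)).state.isRight) ∧
    (x ∈ L → 2 / 3 ≤ M.acceptProb O x (T x.length)) ∧
    (x ∉ L → M.acceptProb O x (T x.length) ≤ 1 / 3)

end OracleTM

/-- `BPE^O`: bounded-error probabilistic time `2^{O(n)}` with oracle `O`. -/
def BPE (O : StringOracle) : Set (Language Bool) :=
  {L | ∃ (M : OracleTM) (c : ℕ), M.DecidesBP O (fun n => 2 ^ (c * n + c)) L}

/-! ### Oracle circuits -/

/-- A gate that reads from `w` wires.  An oracle gate feeds the string on the wires `args` to the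
oracle and outputs bit number `out` of the answer (`0` if the answer has no such bit). -/
inductive Gate (w : ℕ) : Type
  | const (b : Bool)
  | not (i : Fin w)
  | and (i j : Fin w)
  | or (i j : Fin w)
  | oracle (args : List (Fin w)) (out : ℕ)

/-- The output of a gate, given the values on the wires. -/
def Gate.eval {w : ℕ} (O : StringOracle) (v : Fin w → Bool) : Gate w → Bool
  | .const b => b
  | .not i => !(v i)
  | .and i j => v i && v j
  | .or i j => v i || v j
  | .oracle args out => (O (args.map v)).getD out false

/-- The number of wires that enter a gate. -/
def Gate.fanIn {w : ℕ} : Gate w → ℕ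
  | .const _ => 0
  | .not _ => 1
  | .and _ _ => 2
  | .or _ _ => 2
  | .oracle args _ => args.length

/-- A sequence of gates, each reading from the `n` inputs and the earlier gates; `w` counts the
inputs and the gates together. -/
inductive GateSeq (n : ℕ) : ℕ → Type
  | nil : GateSeq n n
  | snoc {w : ℕ} (s : GateSeq n w) (g : Gate w) : GateSeq n (w + 1)

/-- The values on all wires. -/
def GateSeq.eval {n : ℕ} (O : StringOracle) (x : Fin n → Bool) :
    {w : ℕ} → GateSeq n w → Fin w → Bool
  | _, .nil => x
  | _, .snoc s g => Fin.snoc (α := fun _ => Bool) (s.eval O x) (g.eval O (s.eval O x))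

/-- The number of gates plus the number of wires that enter them. -/
def GateSeq.size {n : ℕ} : {w : ℕ} → GateSeq n w → ℕ
  | _, .nil => 0
  | _, .snoc s g => s.size + (1 + g.fanIn)

/-- An oracle circuit with `n` inputs and one output. -/
structure Circuit (n : ℕ) where
  numWires : ℕ
  gates : GateSeq n numWires
  output : Fin numWires

/-- The output of a circuit with oracle `O` on input `x`. -/
def Circuit.eval {n : ℕ} (C : Circuit n) (O : StringOracle) (x : Fin n → Bool) : Bool :=
  C.gates.eval O x C.output

/-- The size of a circuit: gates and wires. -/
def Circuit.size {n : ℕ} (C : Circuit n) : ℕ := C.gates.size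

/-- `L` has `O`-oracle circuits of size at most `s n` on every input length `n`. -/
def HasCircuits (O : StringOracle) (s : ℕ → ℕ) (L : Language Bool) : Prop :=
  ∀ n : ℕ, ∃ C : Circuit n, C.size ≤ s n ∧
    ∀ x : Fin n → Bool, C.eval O x = true ↔ List.ofFn x ∈ L

/-- `SIZE^O[O(n)]`: linear-size `O`-oracle circuits on all input lengths. -/
def LinearSize (O : StringOracle) : Set (Language Bool) :=
  {L | ∃ c : ℕ, HasCircuits O (fun n => c * n + c) L}

/-- `P^O/poly`: polynomial-size `O`-oracle circuits on all input lengths. -/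
def PPoly (O : StringOracle) : Set (Language Bool) :=
  {L | ∃ c : ℕ, HasCircuits O (fun n => n ^ c + c) L}

/-! ### Algebrizing and affine relativizing separations -/

/-- The separation `C ⊄ D` algebrizes: `C` with the multilinear extension of `A` is never contained
in `D` with `A`. -/
def SeparationAlgebrizes (C D : StringOracle → Set (Language Bool)) : Prop :=
  ∀ A : Oracle, ¬ C A.multilinear ⊆ D A.boolean

/-- The separation `C ⊄ D` affine relativizes: it holds relative to the multilinear extension of
every oracle. -/
def SeparationAffineRelativizes (C D : StringOracle → Set (Language Bool)) : Prop :=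
  ∀ A : Oracle, ¬ C A.multilinear ⊆ D A.multilinear

/-!
A bounded-error machine `M` accepts an input with probability at most `1/3` or at least `2/3`. So
it is enough to find an oracle `A` that stores, for every machine, clock and input length `n`,
bits `s x` such that `M` with oracle `Ã` gives the verdict `s x` with probability more than `1/3`
(`EncodesStage`): a circuit that looks up `s x` then decides the language
(`eq_true_iff_of_wrongFrac_lt`). This is a fixed point problem, as storing `s` may change the
verdicts of all machines.

The bits are hidden. Each triple (machine, clock, `n`) is one stage `h`, which owns the strings of
one length `O(h)`, where `h` is at most linear in `n` for a fixed machine and clock and the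
machine runs for at most `2 ^ (h + 1)` steps. These strings hold two half-tables with `2 ^ Ω(h)`
rows each, and `s` is the exclusive or of two rows with the same, secret address. A circuit has
the address built in and needs two oracle gates.

The multilinear extension is linear in the table of one length, so the answer to a query is the
sum of the contributions of the two half-tables (`multilinearExt_side`). Record for every step of
a run both contributions. If two oracles produce the same record, so does every oracle that takes
each half-table from one of the two (`OracleTM.transcript_eq_of_mixed`): the classes of oracles
with equal records are boxes (`BoxLabel`), just as the leaves of a communication protocol are
rectangles. A query concerns strings of one length only, so different stages do not interfere
within an answer.

The main lemma (`uniform_le_plantAvg`) says that planting is not noticed. Let `𝒳` and `𝒴` be dense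
sets of half-tables, take a random row `i`, a random `X ∈ 𝒳`, and a random `Y ∈ 𝒴` subject to `X i
xor Y i = s`. For a label with few classes, all of them rectangles, an average over the planted
pairs is almost the average over `𝒳 × 𝒴`: an entropy count (`sum_card_lowValues_le`) shows that in
a dense set most rows are close to uniform, so a dense rectangle keeps its share, and light
rectangles do not matter.

The oracle is built stage by stage, as a shrinking box of possible half-tables (`StageBox`). The
invariant is that the average over the box of a potential is below `1/2`; an input of a finished
stage contributes `(3w/2) ^ k`, where `w` is the probability of a verdict other than `s x` and `k
= O(h)`, so a potential below `1` means that all `w` are below `2/3`. In a new stage, `s x` is the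
majority verdict of `k` runs. The expected contribution of a majority is exponentially small for
every acceptance probability (`sum_majority_le`), since a majority for a verdict with `w ≥ 2/3` is
rare. Fixing the coins and the records of these runs fixes `s` and leaves a dense box
(`exists_dense_class`); then `s` is planted. As `w ^ k` is the probability that `k` runs all err,
the potential is an average of functions of records, so the planting hardly changes it
(`exists_planted`).

This gives oracles for any finite number of stages (`exists_encoding`). A stage depends on
finitely many values of the oracle, so a limit along an ultrafilter serves all stages
(`exists_encodesStage`). For circuits with the oracle `Ã`, note that `Ã` over the field with two
elements answers the queries to `A` (`multilinear_cubeQuery`).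
-/

/-! ### Planting in dense rectangles -/

section Corruption

variable {R U : Type*} [Fintype U] [DecidableEq U]

/-- The lists in `𝒳` whose row `i` is `a`. -/
def rowFiber (𝒳 : Finset (R → U)) (i : R) (a : U) : Finset (R → U) :=
  𝒳.filter fun X => X i = a

/-- The values that row `i` takes with probability below `(1 - δ) / |U|` on `𝒳`. -/
noncomputable def lowValues (δ : ℝ) (𝒳 : Finset (R → U)) (i : R) : Finset U :=
  Finset.univ.filter fun a =>
    ((rowFiber 𝒳 i a).card : ℝ) * Fintype.card U < (1 - δ) * 𝒳.card

/-- The values that row `i` takes with probability above `(1 + δ) / |U|` on `𝒳`. -/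
noncomputable def highValues (δ : ℝ) (𝒳 : Finset (R → U)) (i : R) : Finset U :=
  Finset.univ.filter fun a =>
    (1 + δ) * 𝒳.card < ((rowFiber 𝒳 i a).card : ℝ) * Fintype.card U

theorem sum_card_rowFiber (𝒳 : Finset (R → U)) (i : R) :
    ∑ a, (rowFiber 𝒳 i a).card = 𝒳.card :=
  (Finset.card_eq_sum_card_fiberwise (fun X _ => Finset.mem_univ (X i))).symm

theorem exp_neg_le_quadratic {x : ℝ} (hx : 0 ≤ x) : Real.exp (-x) ≤ 1 - x + x ^ 2 / 2 := by
  have h := Real.quadratic_le_exp_of_nonneg hx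
  rw [Real.exp_neg, inv_le_comm₀ (Real.exp_pos x) (by nlinarith [sq_nonneg (x - 1)])]
  refine le_trans ?_ h
  rw [inv_le_iff_one_le_mul₀ (by nlinarith [sq_nonneg (x - 1)])]
  nlinarith [sq_nonneg (x ^ 2)]

set_option maxHeartbeats 1000000 in
/-- A dense set of lists has nearly uniform rows on average: the number of rare values, summed over
the rows, is bounded by the logarithm of the inverse density. -/
theorem sum_card_lowValues_le [Fintype R] {δ L : ℝ} (hδ : 0 ≤ δ) (hL : 0 ≤ L)
    (𝒳 : Finset (R → U)) (hX : 𝒳.Nonempty)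
    (hd : (Fintype.card U : ℝ) ^ Fintype.card R ≤ 𝒳.card * (2 : ℝ) ^ L) :
    δ ^ 2 * ∑ i, ((lowValues δ 𝒳 i).card : ℝ) ≤ 2 * L * Fintype.card U := by
  classical
  rcases isEmpty_or_nonempty U with hU | hU
  · have h0 : ∀ i, (lowValues δ 𝒳 i).card = 0 := fun i => by
      rw [Finset.card_eq_zero]; exact Finset.eq_empty_of_isEmpty _
    simp [h0]
  have hu : (0 : ℝ) < Fintype.card U := by exact_mod_cast Fintype.card_pos
  have hXpos : (0 : ℝ) < 𝒳.card := by exact_mod_cast hX.card_pos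
  set u : ℝ := (Fintype.card U : ℝ) with hu_def
  obtain ⟨S, hS⟩ : ∃ S, S = lowValues δ 𝒳 := ⟨_, rfl⟩
  rw [← hS]
  obtain ⟨M, hM⟩ : ∃ M, M = (∑ i, ((S i).card : ℝ)) / u := ⟨_, rfl⟩
  have hM0 : 0 ≤ M := by rw [hM]; positivity
  let Z : (R → U) → ℝ := fun X => ∑ i, if X i ∈ S i then (1 : ℝ) else 0
  have hZ : ∑ X ∈ 𝒳, Z X ≤ (1 - δ) * 𝒳.card * M := by
    have h1 : ∑ X ∈ 𝒳, Z X = ∑ i, ∑ a ∈ S i, ((rowFiber 𝒳 i a).card : ℝ) := by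
      rw [Finset.sum_comm]
      refine Finset.sum_congr rfl fun i _ => ?_
      simp only [rowFiber, Finset.card_filter, Nat.cast_sum]
      rw [Finset.sum_comm]
      refine Finset.sum_congr rfl fun X _ => ?_
      simp
    rw [h1]
    have h2 : ∀ i, ∑ a ∈ S i, ((rowFiber 𝒳 i a).card : ℝ) ≤
        (S i).card * ((1 - δ) * 𝒳.card / u) := by
      intro i
      rw [← nsmul_eq_mul]
      refine Finset.sum_le_card_nsmul _ _ _ fun a ha => ?_
      rw [le_div_iff₀ hu]
      rw [hS] at ha
      exact (Finset.mem_filter.mp ha).2.le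
    calc _ ≤ ∑ i, (S i).card * ((1 - δ) * 𝒳.card / u) := Finset.sum_le_sum fun i _ => h2 i
      _ = (1 - δ) * 𝒳.card * M := by rw [← Finset.sum_mul, hM]; ring
  -- the tangent line of the exponential at the mean bounds the moment generating function on `𝒳`
  have hlow : (𝒳.card : ℝ) * Real.exp (-(δ * (1 - δ) * M)) ≤ ∑ X ∈ 𝒳, Real.exp (-(δ * Z X)) := by
    have h1 : ∀ X, Real.exp (-(δ * (1 - δ) * M)) * (1 + (δ * (1 - δ) * M - δ * Z X)) ≤
        Real.exp (-(δ * Z X)) := by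
      intro X
      have := Real.add_one_le_exp (δ * (1 - δ) * M - δ * Z X)
      calc _ ≤ Real.exp (-(δ * (1 - δ) * M)) * Real.exp (δ * (1 - δ) * M - δ * Z X) := by
            gcongr; linarith
        _ = _ := by rw [← Real.exp_add]; congr 1; ring
    calc _ ≤ Real.exp (-(δ * (1 - δ) * M)) *
          (𝒳.card + (𝒳.card * (δ * (1 - δ) * M) - δ * ∑ X ∈ 𝒳, Z X)) := by
          rw [mul_comm]; gcongr
          nlinarith
      _ = ∑ X ∈ 𝒳, Real.exp (-(δ * (1 - δ) * M)) * (1 + (δ * (1 - δ) * M - δ * Z X)) := by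
          rw [← Finset.mul_sum, Finset.sum_add_distrib, Finset.sum_sub_distrib, Finset.mul_sum]
          simp
      _ ≤ _ := Finset.sum_le_sum fun X _ => h1 X
  have hhigh : ∑ X ∈ 𝒳, Real.exp (-(δ * Z X)) ≤
      u ^ Fintype.card R * Real.exp (-(M * (1 - Real.exp (-δ)))) := by
    calc _ ≤ ∑ X : R → U, Real.exp (-(δ * Z X)) :=
          Finset.sum_le_univ_sum_of_nonneg fun X => (Real.exp_pos _).le
      _ = ∑ X : R → U, ∏ i, (if X i ∈ S i then Real.exp (-δ) else 1) := by
          refine Finset.sum_congr rfl fun X _ => ?_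
          simp only [Z, Finset.mul_sum, ← Finset.sum_neg_distrib, Real.exp_sum]
          refine Finset.prod_congr rfl fun i _ => ?_
          split_ifs <;> simp
      _ = ∏ i, ∑ a, (if a ∈ S i then Real.exp (-δ) else 1) := by
          rw [Finset.prod_univ_sum, Fintype.piFinset_univ]
      _ ≤ ∏ i, (u * Real.exp (-((S i).card / u * (1 - Real.exp (-δ))))) := by
          refine Finset.prod_le_prod (fun i _ => Finset.sum_nonneg fun a _ => ?_) fun i _ => ?_
          · split_ifs <;> positivity
          · have h1 : ∑ a, (if a ∈ S i then Real.exp (-δ) else (1 : ℝ)) =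
                u - (S i).card * (1 - Real.exp (-δ)) := by
              have : ∀ a, (if a ∈ S i then Real.exp (-δ) else (1 : ℝ)) =
                  1 - (if a ∈ S i then (1 - Real.exp (-δ)) else 0) := by
                intro a; split_ifs <;> ring
              simp only [this, Finset.sum_sub_distrib]
              simp [hu_def, mul_sub]
            rw [h1]
            have := Real.add_one_le_exp (-((S i).card / u * (1 - Real.exp (-δ))))
            calc _ = u * (-((S i).card / u * (1 - Real.exp (-δ))) + 1) := by field_simp; ring
              _ ≤ _ := by gcongr
      _ = _ := by
          rw [Finset.prod_mul_distrib, Finset.prod_const, ← Real.exp_sum, Finset.card_univ, hM]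
          congr 2
          rw [Finset.sum_neg_distrib, ← Finset.sum_mul, Finset.sum_div]
  have h2 : (2 : ℝ) ^ L = Real.exp (L * Real.log 2) := by
    rw [Real.rpow_def_of_pos (by norm_num), mul_comm]
  have hcomb : Real.exp (-(δ * (1 - δ) * M)) ≤
      Real.exp (L * Real.log 2 + -(M * (1 - Real.exp (-δ)))) := by
    rw [Real.exp_add, ← h2]
    refine le_of_mul_le_mul_left ?_ hXpos
    calc _ ≤ _ := hlow.trans hhigh
      _ ≤ (𝒳.card * (2 : ℝ) ^ L) * Real.exp (-(M * (1 - Real.exp (-δ)))) := by gcongr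
      _ = _ := by ring
  rw [Real.exp_le_exp] at hcomb
  have hlog : Real.log 2 ≤ 1 := by have := Real.log_two_lt_d9; linarith
  have hq := exp_neg_le_quadratic hδ
  have h3 : M * (δ ^ 2 / 2) ≤ L := by
    have h5 : M * (δ - δ ^ 2 / 2) ≤ M * (1 - Real.exp (-δ)) :=
      mul_le_mul_of_nonneg_left (by linarith) hM0
    have h6 : L * Real.log 2 ≤ L * 1 := mul_le_mul_of_nonneg_left hlog hL
    have h7 : M * (δ ^ 2 / 2) = M * (δ - δ ^ 2 / 2) - δ * (1 - δ) * M := by ring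
    linarith
  have h4 : ∑ i, ((S i).card : ℝ) = M * u := by rw [hM]; field_simp
  rw [h4]
  calc δ ^ 2 * (M * u) = 2 * (M * (δ ^ 2 / 2)) * u := by ring
    _ ≤ 2 * L * u := by gcongr

/-- If few values are rare, then few values are frequent. -/
theorem card_highValues_le {δ : ℝ} (hδ : 0 < δ) (𝒳 : Finset (R → U))
    (hX : 𝒳.Nonempty) (i : R) :
    δ * (highValues δ 𝒳 i).card ≤
      δ ^ 2 * Fintype.card U + (lowValues (δ ^ 2) 𝒳 i).card := by
  classical
  have hXpos : (0 : ℝ) < 𝒳.card := by exact_mod_cast hX.card_pos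
  set u : ℝ := (Fintype.card U : ℝ) with hu_def
  set c : U → ℝ := fun a => (rowFiber 𝒳 i a).card with hc
  have hsum : ∑ a, c a * u = 𝒳.card * u := by
    rw [← Finset.sum_mul]; congr 1; simp only [hc]; exact_mod_cast sum_card_rowFiber 𝒳 i
  have hlb : ∀ a, (𝒳.card : ℝ) * ((1 - δ ^ 2) + (if a ∈ highValues δ 𝒳 i then δ + δ ^ 2 else 0)
      - (if a ∈ lowValues (δ ^ 2) 𝒳 i then 1 - δ ^ 2 else 0)) ≤ c a * u := by
    intro a
    by_cases h1 : a ∈ highValues δ 𝒳 i <;> by_cases h2 : a ∈ lowValues (δ ^ 2) 𝒳 i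
    · have e1 := (Finset.mem_filter.mp h1).2
      have e2 := (Finset.mem_filter.mp h2).2
      nlinarith
    · have e1 := (Finset.mem_filter.mp h1).2
      rw [if_pos h1, if_neg h2]
      simp only [hc]; nlinarith
    · rw [if_neg h1, if_pos h2]
      have : 0 ≤ c a * u := by positivity
      linarith
    · have e2 : (1 - δ ^ 2) * 𝒳.card ≤ c a * u := by
        by_contra h
        exact h2 (Finset.mem_filter.mpr ⟨Finset.mem_univ _, not_le.mp h⟩)
      rw [if_neg h1, if_neg h2]
      linarith
  have h := Finset.sum_le_sum fun a (_ : a ∈ Finset.univ) => hlb a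
  rw [hsum, ← Finset.mul_sum, Finset.sum_sub_distrib, Finset.sum_add_distrib] at h
  have h' := le_of_mul_le_mul_left h hXpos
  simp only [Finset.sum_const, Finset.sum_ite_mem, Finset.univ_inter, nsmul_eq_mul,
    Finset.card_univ] at h'
  rw [← hu_def] at h'
  have p1 : (0 : ℝ) ≤ (highValues δ 𝒳 i).card := by positivity
  have p2 : (0 : ℝ) ≤ (lowValues (δ ^ 2) 𝒳 i).card := by positivity
  nlinarith [mul_nonneg p1 (sq_nonneg δ), mul_nonneg p2 (sq_nonneg δ)]

/-- Choose a row `i` and a list `X ∈ 𝒳` uniformly, then `Y ∈ 𝒴` uniformly among the lists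
whose row `i` is `π (X i)`; this is the expectation of `g X Y`.  If there is no such `Y`, the summand
is `0`, so the total mass is at most one. -/
noncomputable def plantAvg [Fintype R] (𝒳 𝒴 : Finset (R → U)) (π : U → U)
    (g : (R → U) → (R → U) → ℝ) : ℝ :=
  (∑ i, ∑ X ∈ 𝒳, (∑ Y ∈ rowFiber 𝒴 i (π (X i)), g X Y) / (rowFiber 𝒴 i (π (X i))).card) /
    (Fintype.card R * 𝒳.card)

set_option maxHeartbeats 1000000 in
/-- Planting hits every dense rectangle about as often as the uniform distribution does. -/
theorem planted_rectangle_lower [Fintype R] {δ L : ℝ} (hδ : 0 < δ) (hδ1 : δ ≤ 1 / 4) (hL : 0 ≤ L)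
    (𝒳 𝒴 𝒴' : Finset (R → U)) (hYY : 𝒴' ⊆ 𝒴) (hX : 𝒳.Nonempty) (hY : 𝒴'.Nonempty)
    (π : Equiv.Perm U)
    (hdX : (Fintype.card U : ℝ) ^ Fintype.card R ≤ 𝒳.card * (2 : ℝ) ^ L)
    (hdY : (Fintype.card U : ℝ) ^ Fintype.card R ≤ 𝒴'.card * (2 : ℝ) ^ L)
    (hR : 2 * L ≤ Fintype.card R * δ ^ 6) :
    (1 - 7 * δ) * (Fintype.card R * (𝒳.card * 𝒴'.card) / 𝒴.card) ≤
      ∑ i, ∑ X ∈ 𝒳, ((rowFiber 𝒴' i (π (X i))).card : ℝ) / (rowFiber 𝒴 i (π (X i))).card := by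
  classical
  have hYne : 𝒴.Nonempty := hY.mono hYY
  rcases isEmpty_or_nonempty R with hRe | hRe
  · simp
  have hU : Nonempty U := by
    obtain ⟨X, _⟩ := hX
    exact ⟨X (Classical.arbitrary R)⟩
  have hu : (0 : ℝ) < Fintype.card U := by exact_mod_cast Fintype.card_pos
  have hXp : (0 : ℝ) < 𝒳.card := by exact_mod_cast hX.card_pos
  have hYp' : (0 : ℝ) < 𝒴'.card := by exact_mod_cast hY.card_pos
  have hYp : (0 : ℝ) < 𝒴.card := by exact_mod_cast hYne.card_pos
  have hdYY : (Fintype.card U : ℝ) ^ Fintype.card R ≤ 𝒴.card * (2 : ℝ) ^ L := by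
    refine hdY.trans ?_
    gcongr
  set u : ℝ := (Fintype.card U : ℝ) with hu_def
  set r : ℝ := (Fintype.card R : ℝ) with hr_def
  have hr : 0 < r := by rw [hr_def]; exact_mod_cast Fintype.card_pos
  set K : ℝ := (1 - 3 * δ) / u * (𝒳.card * 𝒴'.card / 𝒴.card) with hK
  have hKn : 0 ≤ K := by
    have : 0 ≤ 1 - 3 * δ := by linarith
    positivity
  let bad : R → Finset U := fun i => lowValues δ 𝒳 i ∪
    ((lowValues δ 𝒴' i) ∪ highValues δ 𝒴 i).map π.symm.toEmbedding
  have hrow : ∀ i, ∑ X ∈ 𝒳, ((rowFiber 𝒴' i (π (X i))).card : ℝ) / (rowFiber 𝒴 i (π (X i))).card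
      = ∑ a, ((rowFiber 𝒳 i a).card : ℝ) *
        (((rowFiber 𝒴' i (π a)).card : ℝ) / (rowFiber 𝒴 i (π a)).card) := by
    intro i
    rw [← Finset.sum_fiberwise_of_maps_to (s := 𝒳) (t := Finset.univ) (g := fun X => X i)
      (fun _ _ => Finset.mem_univ _)]
    refine Finset.sum_congr rfl fun a _ => ?_
    rw [← nsmul_eq_mul, rowFiber]
    rw [← Finset.sum_const]
    refine Finset.sum_congr rfl fun X hX => ?_
    rw [(Finset.mem_filter.mp hX).2]
  have hterm : ∀ i a, a ∉ bad i → K ≤ ((rowFiber 𝒳 i a).card : ℝ) *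
        (((rowFiber 𝒴' i (π a)).card : ℝ) / (rowFiber 𝒴 i (π a)).card) := by
    intro i a ha
    simp only [bad, Finset.mem_union, Finset.mem_map_equiv, Equiv.symm_symm, not_or] at ha
    obtain ⟨h1, h2, h3⟩ := ha
    simp only [lowValues, highValues, Finset.mem_filter, Finset.mem_univ, true_and, not_lt]
      at h1 h2 h3
    rw [← hu_def] at h1 h2 h3
    set x : ℝ := ((rowFiber 𝒳 i a).card : ℝ)
    set y' : ℝ := ((rowFiber 𝒴' i (π a)).card : ℝ) with hy'_def
    set y : ℝ := ((rowFiber 𝒴 i (π a)).card : ℝ) with hy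
    have hy'y : y' ≤ y := by
      rw [hy, hy'_def]
      exact Nat.cast_le.mpr (Finset.card_le_card (Finset.filter_subset_filter _ hYY))
    have hy'0 : 0 < y' := by
      have : 0 < y' * u := lt_of_lt_of_le (by nlinarith) h2
      exact pos_of_mul_pos_left this hu.le
    have hy0 : 0 < y := hy'0.trans_le hy'y
    have e1 : (1 - δ) * 𝒳.card / u ≤ x := by rw [div_le_iff₀ hu]; exact h1
    have e2 : (1 - δ) * 𝒴'.card / ((1 + δ) * 𝒴.card) ≤ y' / y := by
      rw [div_le_div_iff₀ (by positivity) hy0]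
      have : 0 ≤ (1 - δ) * (𝒴'.card : ℝ) := by nlinarith
      have := mul_le_mul h2 h3 (by positivity) (by positivity)
      have h4 : ((1 - δ) * 𝒴'.card * y) * u ≤ (y' * ((1 + δ) * 𝒴.card)) * u := by nlinarith
      exact le_of_mul_le_mul_right h4 hu
    have h1δ : 0 ≤ 1 - δ := by linarith
    have e3 : 1 - 3 * δ ≤ (1 - δ) * ((1 - δ) / (1 + δ)) := by
      rw [mul_div_assoc', le_div_iff₀ (by linarith)]
      nlinarith
    calc K ≤ (1 - δ) * ((1 - δ) / (1 + δ)) / u * (𝒳.card * 𝒴'.card / 𝒴.card) := by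
          rw [hK]; gcongr
      _ = ((1 - δ) * 𝒳.card / u) * ((1 - δ) * 𝒴'.card / ((1 + δ) * 𝒴.card)) := by
          field_simp
      _ ≤ x * (y' / y) := by gcongr
  have hsum : ∀ i, (u - (bad i).card) * K ≤ ∑ a, ((rowFiber 𝒳 i a).card : ℝ) *
        (((rowFiber 𝒴' i (π a)).card : ℝ) / (rowFiber 𝒴 i (π a)).card) := by
    intro i
    calc (u - (bad i).card) * K = ∑ a ∈ Finset.univ \ bad i, K := by
          rw [Finset.sum_const, nsmul_eq_mul, Finset.card_sdiff_of_subset (Finset.subset_univ _),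
            Finset.card_univ, Nat.cast_sub (Finset.card_le_univ _)]
      _ ≤ ∑ a ∈ Finset.univ \ bad i, ((rowFiber 𝒳 i a).card : ℝ) *
        (((rowFiber 𝒴' i (π a)).card : ℝ) / (rowFiber 𝒴 i (π a)).card) := by
          refine Finset.sum_le_sum fun a ha => ?_
          exact hterm i a (Finset.mem_sdiff.mp ha).2
      _ ≤ _ := Finset.sum_le_univ_sum_of_nonneg fun a => by positivity
  have hbad : ∑ i, ((bad i).card : ℝ) ≤ 4 * δ * r * u := by
    have h1 := sum_card_lowValues_le hδ.le hL 𝒳 hX hdX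
    have h2 := sum_card_lowValues_le hδ.le hL 𝒴' hY hdY
    have h3 := sum_card_lowValues_le (δ := δ ^ 2) (by positivity) hL 𝒴 hYne hdYY
    have h4 : δ * ∑ i, ((highValues δ 𝒴 i).card : ℝ) ≤
        r * (δ ^ 2 * u) + ∑ i, ((lowValues (δ ^ 2) 𝒴 i).card : ℝ) := by
      have := Finset.sum_le_sum fun i (_ : i ∈ Finset.univ) =>
        card_highValues_le hδ 𝒴 hYne i
      rw [Finset.sum_add_distrib, ← Finset.mul_sum] at this
      simpa using this
    have h5 : ∑ i, ((bad i).card : ℝ) ≤ ∑ i, ((lowValues δ 𝒳 i).card : ℝ) +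
        (∑ i, ((lowValues δ 𝒴' i).card : ℝ) + ∑ i, ((highValues δ 𝒴 i).card : ℝ)) := by
      rw [← Finset.sum_add_distrib, ← Finset.sum_add_distrib]
      refine Finset.sum_le_sum fun i _ => ?_
      have a1 : (bad i).card ≤ _ := Finset.card_union_le _ _
      rw [Finset.card_map] at a1
      have a2 := Finset.card_union_le (lowValues δ 𝒴' i) (highValues δ 𝒴 i)
      exact_mod_cast a1.trans (by omega)
    set s1 := ∑ i, ((lowValues δ 𝒳 i).card : ℝ)
    set s2 := ∑ i, ((lowValues δ 𝒴' i).card : ℝ)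
    set s3 := ∑ i, ((lowValues (δ ^ 2) 𝒴 i).card : ℝ)
    set s4 := ∑ i, ((highValues δ 𝒴 i).card : ℝ)
    have hL6 : 2 * L * u ≤ r * δ ^ 6 * u := by gcongr
    have b1 : s1 ≤ r * δ ^ 4 * u := by
      have : δ ^ 2 * s1 ≤ δ ^ 2 * (r * δ ^ 4 * u) := by
        refine (h1.trans hL6).trans (le_of_eq ?_); ring
      exact le_of_mul_le_mul_left this (by positivity)
    have b2 : s2 ≤ r * δ ^ 4 * u := by
      have : δ ^ 2 * s2 ≤ δ ^ 2 * (r * δ ^ 4 * u) := by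
        refine (h2.trans hL6).trans (le_of_eq ?_); ring
      exact le_of_mul_le_mul_left this (by positivity)
    have b3 : s3 ≤ r * δ ^ 2 * u := by
      have : (δ ^ 2) ^ 2 * s3 ≤ (δ ^ 2) ^ 2 * (r * δ ^ 2 * u) := by
        refine (h3.trans hL6).trans (le_of_eq ?_); ring
      exact le_of_mul_le_mul_left this (by positivity)
    have b4 : s4 ≤ 2 * δ * (r * u) := by
      have : δ * s4 ≤ δ * (2 * δ * (r * u)) := by nlinarith
      exact le_of_mul_le_mul_left this hδ
    have hd4 : δ ^ 4 ≤ δ := by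
      calc δ ^ 4 ≤ δ ^ 1 := pow_le_pow_of_le_one hδ.le (by linarith) (by norm_num)
        _ = δ := pow_one δ
    have : r * δ ^ 4 * u ≤ r * δ * u := by gcongr
    linarith
  simp_rw [hrow]
  calc _ ≤ (r * u - ∑ i, ((bad i).card : ℝ)) * K := by
        have : (r * u - 4 * δ * r * u) * K ≤ (r * u - ∑ i, ((bad i).card : ℝ)) * K := by gcongr
        refine le_trans ?_ this
        have e : (r * u - 4 * δ * r * u) * K =
            ((1 - 4 * δ) * (1 - 3 * δ)) * (r * (𝒳.card * 𝒴'.card) / 𝒴.card) := by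
          rw [hK]; field_simp
        rw [e]
        gcongr
        nlinarith
    _ = ∑ i, (u - (bad i).card) * K := by
        rw [← Finset.sum_mul, Finset.sum_sub_distrib]
        simp [hr_def]
    _ ≤ _ := Finset.sum_le_sum fun i _ => hsum i

end Corruption

section Planting

variable {R U : Type*} [DecidableEq U]

/-- A labelling of pairs all of whose classes are rectangles. -/
def RectLabel {α β Λ : Type*} (lab : α → β → Λ) : Prop :=
  ∀ X X' Y Y', lab X Y' = lab X' Y → lab X Y = lab X Y'

theorem plantAvg_add [Fintype R] (𝒳 𝒴 : Finset (R → U)) (π : U → U)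
    (g g' : (R → U) → (R → U) → ℝ) :
    plantAvg 𝒳 𝒴 π (fun X Y => g X Y + g' X Y) = plantAvg 𝒳 𝒴 π g + plantAvg 𝒳 𝒴 π g' := by
  simp only [plantAvg, Finset.sum_add_distrib, add_div]

theorem plantAvg_const_mul [Fintype R] (𝒳 𝒴 : Finset (R → U)) (π : U → U)
    (g : (R → U) → (R → U) → ℝ) (c : ℝ) :
    plantAvg 𝒳 𝒴 π (fun X Y => c * g X Y) = c * plantAvg 𝒳 𝒴 π g := by
  simp only [plantAvg, ← Finset.mul_sum, mul_div_assoc]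

theorem plantAvg_sum [Fintype R] {W : Type*} (𝒳 𝒴 : Finset (R → U)) (π : U → U)
    (s : Finset W) (g : W → (R → U) → (R → U) → ℝ) :
    plantAvg 𝒳 𝒴 π (fun X Y => ∑ w ∈ s, g w X Y) = ∑ w ∈ s, plantAvg 𝒳 𝒴 π (g w) := by
  classical
  induction s using Finset.induction_on with
  | empty => simp [plantAvg]
  | insert a s ha ih => simp only [Finset.sum_insert ha, plantAvg_add, ih]

theorem plantAvg_mono [Fintype R] (𝒳 𝒴 : Finset (R → U)) (π : U → U)
    {g g' : (R → U) → (R → U) → ℝ}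
    (h : ∀ i, ∀ X ∈ 𝒳, ∀ Y ∈ 𝒴, Y i = π (X i) → g X Y ≤ g' X Y) :
    plantAvg 𝒳 𝒴 π g ≤ plantAvg 𝒳 𝒴 π g' := by
  unfold plantAvg
  gcongr with i _ X hX Y hY
  exact h i X hX Y (Finset.mem_filter.mp hY).1 (Finset.mem_filter.mp hY).2

theorem plantAvg_one_le [Fintype R] (𝒳 𝒴 : Finset (R → U)) (π : U → U) :
    plantAvg 𝒳 𝒴 π (fun _ _ => 1) ≤ 1 := by
  unfold plantAvg
  refine div_le_one_of_le₀ ?_ (by positivity)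
  calc _ ≤ ∑ i : R, ∑ X ∈ 𝒳, (1 : ℝ) := by
        refine Finset.sum_le_sum fun i _ => Finset.sum_le_sum fun X _ => ?_
        simpa using div_self_le_one _
    _ = _ := by simp

set_option maxHeartbeats 1000000 in
/-- The planted distribution cannot be told from the uniform one by a labelling with few classes, all
of them rectangles. -/
theorem uniform_le_plantAvg [Fintype U] [Fintype R] [Nonempty R] {Λ : Type*} [Fintype Λ]
    (lab : (R → U) → (R → U) → Λ)
    (hlab : RectLabel lab) (G : Λ → ℝ) {B : ℝ} (hG : ∀ l, 0 ≤ G l) (hGB : ∀ l, G l ≤ B)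
    {δ D ℓ d : ℝ} (hδ : 0 < δ) (hδ1 : δ ≤ 1 / 4) (hD : 0 ≤ D) (hℓ : 0 ≤ ℓ) (hd : 0 ≤ d)
    (hδd : 1 ≤ δ * (2 : ℝ) ^ d) (hΛ : (Fintype.card Λ : ℝ) ≤ (2 : ℝ) ^ ℓ)
    (hR : 2 * (D + ℓ + d) ≤ Fintype.card R * δ ^ 6)
    (𝒳 𝒴 : Finset (R → U)) (hX : 𝒳.Nonempty) (hY : 𝒴.Nonempty) (π : Equiv.Perm U)
    (hdX : (Fintype.card U : ℝ) ^ Fintype.card R ≤ 𝒳.card * (2 : ℝ) ^ D)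
    (hdY : (Fintype.card U : ℝ) ^ Fintype.card R ≤ 𝒴.card * (2 : ℝ) ^ D) :
    (∑ X ∈ 𝒳, ∑ Y ∈ 𝒴, G (lab X Y)) / (𝒳.card * 𝒴.card) - 8 * δ * B ≤
      plantAvg 𝒳 𝒴 π (fun X Y => G (lab X Y)) := by
  classical
  have hXp : (0 : ℝ) < 𝒳.card := by exact_mod_cast hX.card_pos
  have hYp : (0 : ℝ) < 𝒴.card := by exact_mod_cast hY.card_pos
  have hΛne : Nonempty Λ := by
    obtain ⟨X, _⟩ := hX
    exact ⟨lab X X⟩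
  have hΛp : (0 : ℝ) < Fintype.card Λ := by exact_mod_cast Fintype.card_pos
  have hrp : (0 : ℝ) < Fintype.card R := by exact_mod_cast Fintype.card_pos
  have hB : 0 ≤ B := (hG (Classical.arbitrary Λ)).trans (hGB _)
  obtain ⟨𝒳l, h𝒳l⟩ : ∃ 𝒳l : Λ → Finset (R → U),
      ∀ l X, X ∈ 𝒳l l ↔ X ∈ 𝒳 ∧ ∃ Y ∈ 𝒴, lab X Y = l :=
    ⟨fun l => 𝒳.filter fun X => ∃ Y ∈ 𝒴, lab X Y = l, fun l X => Finset.mem_filter⟩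
  obtain ⟨𝒴l, h𝒴l⟩ : ∃ 𝒴l : Λ → Finset (R → U),
      ∀ l Y, Y ∈ 𝒴l l ↔ Y ∈ 𝒴 ∧ ∃ X ∈ 𝒳, lab X Y = l :=
    ⟨fun l => 𝒴.filter fun Y => ∃ X ∈ 𝒳, lab X Y = l, fun l X => Finset.mem_filter⟩
  have h𝒳s : ∀ l, 𝒳l l ⊆ 𝒳 := fun l X hX => ((h𝒳l l X).mp hX).1
  have h𝒴s : ∀ l, 𝒴l l ⊆ 𝒴 := fun l Y hY => ((h𝒴l l Y).mp hY).1
  let ind : Λ → (R → U) → (R → U) → ℝ := fun l X Y => if X ∈ 𝒳l l ∧ Y ∈ 𝒴l l then 1 else 0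
  have hmem : ∀ X ∈ 𝒳, ∀ Y ∈ 𝒴, ∀ l, (X ∈ 𝒳l l ∧ Y ∈ 𝒴l l) ↔ l = lab X Y := by
    intro X hX Y hY l
    rw [h𝒳l, h𝒴l]
    constructor
    · rintro ⟨⟨_, Y', hY', h1⟩, ⟨_, X', hX', h2⟩⟩
      rw [hlab X X' Y Y' (h1.trans h2.symm), h1]
    · rintro rfl
      exact ⟨⟨hX, Y, hY, rfl⟩, ⟨hY, X, hX, rfl⟩⟩
  have hexp : ∀ X ∈ 𝒳, ∀ Y ∈ 𝒴, G (lab X Y) = ∑ l, G l * ind l X Y := by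
    intro X hX Y hY
    simp only [ind, hmem X hX Y hY]
    simp
  have hsum : ∀ g : (R → U) → (R → U) → ℝ, (∀ X ∈ 𝒳, ∀ Y ∈ 𝒴, g X Y = G (lab X Y)) →
      ∑ X ∈ 𝒳, ∑ Y ∈ 𝒴, g X Y = ∑ X ∈ 𝒳, ∑ Y ∈ 𝒴, G (lab X Y) := fun g hg =>
    Finset.sum_congr rfl fun X hX => Finset.sum_congr rfl fun Y hY => hg X hX Y hY
  have hplant : plantAvg 𝒳 𝒴 π (fun X Y => G (lab X Y)) =
      ∑ l, G l * plantAvg 𝒳 𝒴 π (ind l) := by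
    have : plantAvg 𝒳 𝒴 π (fun X Y => G (lab X Y)) =
        plantAvg 𝒳 𝒴 π (fun X Y => ∑ l, G l * ind l X Y) :=
      le_antisymm (plantAvg_mono _ _ _ fun i X hX Y hY _ => (hexp X hX Y hY).le)
        (plantAvg_mono _ _ _ fun i X hX Y hY _ => (hexp X hX Y hY).ge)
    rw [this, plantAvg_sum]
    refine Finset.sum_congr rfl fun l _ => ?_
    rw [plantAvg_const_mul]
  have hindsum : ∀ l, ∑ X ∈ 𝒳, ∑ Y ∈ 𝒴, ind l X Y = ((𝒳l l).card * (𝒴l l).card : ℝ) := by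
    intro l
    have h1 : ∀ X ∈ 𝒳, ∑ Y ∈ 𝒴, ind l X Y = if X ∈ 𝒳l l then ((𝒴l l).card : ℝ) else 0 := by
      intro X _
      by_cases h : X ∈ 𝒳l l
      · simp only [ind, h, true_and, if_true]
        rw [Finset.sum_ite_mem, Finset.inter_eq_right.mpr (h𝒴s l)]
        simp
      · simp [ind, h]
    rw [Finset.sum_congr rfl h1, Finset.sum_ite_mem, Finset.inter_eq_right.mpr (h𝒳s l)]
    simp
  have hunif : ∑ X ∈ 𝒳, ∑ Y ∈ 𝒴, G (lab X Y) =
      ∑ l, G l * ((𝒳l l).card * (𝒴l l).card : ℝ) := by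
    rw [← hsum (fun X Y => ∑ l, G l * ind l X Y) fun X hX Y hY => (hexp X hX Y hY).symm]
    simp_rw [← hindsum, Finset.mul_sum]
    rw [Finset.sum_comm (s := Finset.univ)]
    refine Finset.sum_congr rfl fun X _ => ?_
    rw [Finset.sum_comm (s := Finset.univ)]
  have hmass : ∑ l, ((𝒳l l).card * (𝒴l l).card : ℝ) = 𝒳.card * 𝒴.card := by
    simp_rw [← hindsum]
    rw [Finset.sum_comm]
    have : ∀ X ∈ 𝒳, ∑ l, ∑ Y ∈ 𝒴, ind l X Y = 𝒴.card := by
      intro X hX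
      rw [Finset.sum_comm]
      have : ∀ Y ∈ 𝒴, ∑ l, ind l X Y = 1 := by
        intro Y hY
        simp only [ind, hmem X hX Y hY]
        simp
      rw [Finset.sum_congr rfl this]
      simp
    rw [Finset.sum_congr rfl this]
    simp
  have hcell : ∀ l, (1 - 7 * δ) * ((𝒳l l).card * (𝒴l l).card / (𝒳.card * 𝒴.card)) -
      δ / Fintype.card Λ ≤ plantAvg 𝒳 𝒴 π (ind l) := by
    intro l
    have hnn : 0 ≤ plantAvg 𝒳 𝒴 π (ind l) := by
      have : ∀ X Y, 0 ≤ ind l X Y := fun X Y => by simp only [ind]; split_ifs <;> norm_num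
      unfold plantAvg
      exact div_nonneg (Finset.sum_nonneg fun i _ => Finset.sum_nonneg fun X _ =>
        div_nonneg (Finset.sum_nonneg fun Y _ => this X Y) (Nat.cast_nonneg _)) (by positivity)
    have hx1 : ((𝒳l l).card : ℝ) ≤ 𝒳.card := by exact_mod_cast Finset.card_le_card (h𝒳s l)
    have hy1 : ((𝒴l l).card : ℝ) ≤ 𝒴.card := by exact_mod_cast Finset.card_le_card (h𝒴s l)
    have hθ : 0 < δ / Fintype.card Λ := by positivity
    have hsmall : ((𝒳l l).card * (𝒴l l).card / (𝒳.card * 𝒴.card) : ℝ) ≤ δ / Fintype.card Λ →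
        (1 - 7 * δ) * ((𝒳l l).card * (𝒴l l).card / (𝒳.card * 𝒴.card)) -
          δ / Fintype.card Λ ≤ plantAvg 𝒳 𝒴 π (ind l) := by
      intro h
      have h0 : (0 : ℝ) ≤ (𝒳l l).card * (𝒴l l).card / (𝒳.card * 𝒴.card) := by positivity
      nlinarith
    by_cases hx : ((𝒳l l).card : ℝ) ≤ δ / Fintype.card Λ * 𝒳.card
    · apply hsmall
      rw [div_le_iff₀ (by positivity)]
      calc _ ≤ δ / Fintype.card Λ * 𝒳.card * 𝒴.card := by gcongr
        _ = _ := by ring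
    by_cases hy : ((𝒴l l).card : ℝ) ≤ δ / Fintype.card Λ * 𝒴.card
    · apply hsmall
      rw [div_le_iff₀ (by positivity)]
      calc _ ≤ 𝒳.card * (δ / Fintype.card Λ * 𝒴.card) := by gcongr
        _ = _ := by ring
    rw [not_le] at hx hy
    have hdens : ∀ a b : ℝ, 0 ≤ a → δ / Fintype.card Λ * a < b →
        (Fintype.card U : ℝ) ^ Fintype.card R ≤ a * (2 : ℝ) ^ D →
        (Fintype.card U : ℝ) ^ Fintype.card R ≤ b * (2 : ℝ) ^ (D + ℓ + d) := by
      intro a b ha hab h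
      have h1 : a ≤ b * (Fintype.card Λ * (2 : ℝ) ^ d) := by
        calc a ≤ a * (δ * (2 : ℝ) ^ d) := le_mul_of_one_le_right ha hδd
          _ = (δ / Fintype.card Λ * a) * (Fintype.card Λ * (2 : ℝ) ^ d) := by field_simp
          _ ≤ _ := by gcongr
      have hb : 0 ≤ b := le_trans (by positivity) hab.le
      calc _ ≤ _ := h
        _ ≤ (b * (Fintype.card Λ * (2 : ℝ) ^ d)) * (2 : ℝ) ^ D := by gcongr
        _ ≤ (b * ((2 : ℝ) ^ ℓ * (2 : ℝ) ^ d)) * (2 : ℝ) ^ D := by gcongr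
        _ = _ := by rw [Real.rpow_add (by norm_num), Real.rpow_add (by norm_num)]; ring
    have hxne : (𝒳l l).Nonempty := by
      rw [← Finset.card_pos, ← Nat.cast_pos (α := ℝ)]
      exact lt_of_le_of_lt (by positivity) hx
    have hyne : (𝒴l l).Nonempty := by
      rw [← Finset.card_pos, ← Nat.cast_pos (α := ℝ)]
      exact lt_of_le_of_lt (by positivity) hy
    have key := planted_rectangle_lower hδ hδ1 (by positivity) (𝒳l l) 𝒴 (𝒴l l) (h𝒴s l) hxne
      hyne π (hdens _ _ hXp.le hx hdX) (hdens _ _ hYp.le hy hdY) hR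
    have heq : plantAvg 𝒳 𝒴 π (ind l) = (∑ i, ∑ X ∈ 𝒳l l,
        ((rowFiber (𝒴l l) i (π (X i))).card : ℝ) / (rowFiber 𝒴 i (π (X i))).card) /
          (Fintype.card R * 𝒳.card) := by
      unfold plantAvg
      congr 1
      refine Finset.sum_congr rfl fun i _ => ?_
      rw [← Finset.sum_subset (h𝒳s l)]
      · refine Finset.sum_congr rfl fun X hX => ?_
        congr 1
        simp only [ind, hX, true_and]
        rw [Finset.sum_boole]
        congr 2
        ext Y
        simp only [rowFiber, Finset.mem_filter]
        exact ⟨fun h => ⟨h.2, h.1.2⟩, fun h => ⟨⟨h𝒴s l h.1, h.2⟩, h.1⟩⟩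
      · intro X _ hX
        simp [ind, hX]
    rw [heq, le_div_iff₀ (by positivity)]
    refine le_trans ?_ key
    have : 0 ≤ δ / Fintype.card Λ * (Fintype.card R * 𝒳.card : ℝ) := by positivity
    calc _ ≤ (1 - 7 * δ) * ((𝒳l l).card * (𝒴l l).card / (𝒳.card * 𝒴.card)) *
          (Fintype.card R * 𝒳.card : ℝ) := by linarith
      _ = _ := by field_simp
  rw [hplant, hunif]
  set m : Λ → ℝ := fun l => (𝒳l l).card * (𝒴l l).card / (𝒳.card * 𝒴.card) with hm
  have hm1 : ∑ l, m l = 1 := by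
    rw [hm, ← Finset.sum_div, hmass]; field_simp
  have e1 : (∑ l, G l * ((𝒳l l).card * (𝒴l l).card : ℝ)) / (𝒳.card * 𝒴.card) =
      ∑ l, G l * m l := by
    rw [Finset.sum_div]
    refine Finset.sum_congr rfl fun l _ => ?_
    rw [hm, mul_div_assoc]
  rw [e1]
  have hm0 : ∀ l, 0 ≤ m l := fun l => by rw [hm]; positivity
  have e2 : ∀ l, G l * m l - (7 * δ * B * m l + B * (δ / Fintype.card Λ)) ≤
      G l * plantAvg 𝒳 𝒴 π (ind l) := by
    intro l
    have h1 := mul_le_mul_of_nonneg_left (hcell l) (hG l)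
    have h2 : G l * (7 * δ * m l + δ / Fintype.card Λ) ≤ B * (7 * δ * m l + δ / Fintype.card Λ) :=
      mul_le_mul_of_nonneg_right (hGB l) (by have := hm0 l; positivity)
    refine le_trans ?_ h1
    rw [hm] at h2 ⊢
    simp only at h2 ⊢
    linarith
  calc _ = ∑ l, (G l * m l - (7 * δ * B * m l + B * (δ / Fintype.card Λ))) := by
        rw [Finset.sum_sub_distrib, Finset.sum_add_distrib, ← Finset.mul_sum, hm1]
        rw [Finset.sum_const, Finset.card_univ, nsmul_eq_mul]
        field_simp
        ring
    _ ≤ _ := Finset.sum_le_sum fun l _ => e2 l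

end Planting

/-! ### Boxes and labels whose classes are boxes -/

section Boxes

variable {ι : Type*} [DecidableEq ι] {F : ι → Type*}

/-- A labelling of families `f` all of whose classes are boxes: mixing the coordinates of two families
with the same label does not change the label. -/
def BoxLabel {Λ : Type*} (tr : (∀ i, F i) → Λ) : Prop :=
  ∀ (f g : ∀ i, F i) (S : Finset ι), tr f = tr g → tr (S.piecewise f g) = tr f

theorem BoxLabel.pi {κ : Type*} {Λ : κ → Type*} {tr : ∀ k, (∀ i, F i) → Λ k}
    (h : ∀ k, BoxLabel (tr k)) : BoxLabel fun f k => tr k f := fun f g S hfg =>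
  funext fun k => h k f g S (congrFun hfg k)

variable [Fintype ι]

/-- The average of `g` over a box. -/
noncomputable def boxAvg (B : ∀ i, Finset (F i)) (g : (∀ i, F i) → ℝ) : ℝ :=
  (∑ f ∈ Fintype.piFinset B, g f) / (Fintype.piFinset B).card

theorem boxAvg_add (B : ∀ i, Finset (F i)) (g g' : (∀ i, F i) → ℝ) :
    boxAvg B (fun f => g f + g' f) = boxAvg B g + boxAvg B g' := by
  simp only [boxAvg, Finset.sum_add_distrib, add_div]

theorem boxAvg_sum {W : Type*} (B : ∀ i, Finset (F i)) (s : Finset W)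
    (g : W → (∀ i, F i) → ℝ) :
    boxAvg B (fun f => ∑ w ∈ s, g w f) = ∑ w ∈ s, boxAvg B (g w) := by
  simp only [boxAvg]
  rw [Finset.sum_comm, Finset.sum_div]

theorem boxAvg_mono (B : ∀ i, Finset (F i)) {g g' : (∀ i, F i) → ℝ}
    (h : ∀ f ∈ Fintype.piFinset B, g f ≤ g' f) : boxAvg B g ≤ boxAvg B g' := by
  unfold boxAvg
  gcongr with f hf
  exact h f hf

theorem boxAvg_const {B : ∀ i, Finset (F i)} (hB : (Fintype.piFinset B).Nonempty) (c : ℝ) :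
    boxAvg B (fun _ => c) = c := by
  have : (0 : ℝ) < (Fintype.piFinset B).card := by exact_mod_cast hB.card_pos
  rw [boxAvg, Finset.sum_const, nsmul_eq_mul]
  field_simp

theorem BoxLabel.exists_box [Nonempty ι] {Λ : Type*} {tr : (∀ i, F i) → Λ} (h : BoxLabel tr)
    (B : ∀ i, Finset (F i)) (t : Λ) :
    ∃ B' : ∀ i, Finset (F i), (∀ i, B' i ⊆ B i) ∧
      ∀ f, f ∈ Fintype.piFinset B' ↔ f ∈ Fintype.piFinset B ∧ tr f = t := by
  classical
  by_cases hne : ∃ f ∈ Fintype.piFinset B, tr f = t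
  swap
  · refine ⟨fun _ => ∅, fun i => by simp, fun f => ?_⟩
    refine iff_of_false (fun hf => ?_) fun hf => hne ⟨f, hf⟩
    simpa using Fintype.mem_piFinset.mp hf (Classical.arbitrary ι)
  obtain ⟨g, hgB, hgt⟩ := hne
  let C := (Fintype.piFinset B).filter fun f => tr f = t
  refine ⟨fun i => C.image fun f => f i, fun i a ha => ?_, fun f => ⟨fun hf => ?_, fun hf => ?_⟩⟩
  · obtain ⟨f, hf, rfl⟩ := Finset.mem_image.mp ha
    exact Fintype.mem_piFinset.mp (Finset.mem_filter.mp hf).1 i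
  · have hc : ∀ i, ∃ f' ∈ C, f' i = f i := fun i =>
      Finset.mem_image.mp (Fintype.mem_piFinset.mp hf i)
    choose c hcC hci using hc
    -- move from `g` to `f` one coordinate at a time, staying in the class of `t`
    have key : ∀ S : Finset ι, S.piecewise f g ∈ C := by
      intro S
      induction S using Finset.induction_on with
      | empty => simpa [C] using ⟨Fintype.mem_piFinset.mp hgB, hgt⟩
      | insert i S hi ih =>
        have e : (insert i S).piecewise f g = ({i} : Finset ι).piecewise (c i) (S.piecewise f g) := by
          funext j
          by_cases hj : j = i
          · subst hj; simp [hci]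
          · simp [Finset.piecewise, hj]
        have h1 := Finset.mem_filter.mp (hcC i)
        have h2 := Finset.mem_filter.mp ih
        rw [e]
        refine Finset.mem_filter.mpr ⟨Fintype.mem_piFinset.mpr fun j => ?_, ?_⟩
        · by_cases hj : j = i
          · subst hj; simpa using Fintype.mem_piFinset.mp h1.1 j
          · have := Fintype.mem_piFinset.mp h2.1 j
            simpa [Finset.piecewise, hj] using this
        · rw [h _ _ _ (h1.2.trans h2.2.symm), h1.2]
    have := key Finset.univ
    rw [Finset.piecewise_univ] at this
    exact Finset.mem_filter.mp this
  · exact Fintype.mem_piFinset.mpr fun i =>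
      Finset.mem_image.mpr ⟨f, Finset.mem_filter.mpr hf, rfl⟩

/-- A box inside another one that is dense in it is dense in every coordinate. -/
theorem dense_coordinate {B B' : ∀ i, Finset (F i)} (hsub : ∀ i, B' i ⊆ B i)
    (hne : (Fintype.piFinset B).Nonempty) {c : ℝ}
    (h : c * (Fintype.piFinset B).card ≤ (Fintype.piFinset B').card) (i : ι) :
    c * (B i).card ≤ (B' i).card := by
  rw [Fintype.card_piFinset, Fintype.card_piFinset, ← Finset.mul_prod_erase _ _ (Finset.mem_univ i),
    ← Finset.mul_prod_erase _ (fun j => (B' j).card) (Finset.mem_univ i)] at h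
  have hpos : (0 : ℝ) < ((∏ j ∈ Finset.univ.erase i, (B j).card : ℕ) : ℝ) := by
    rw [Nat.cast_pos]
    exact Finset.prod_pos fun j _ =>
      Finset.card_pos.mpr ((Fintype.piFinset_nonempty.mp hne) j)
  have hle : ((∏ j ∈ Finset.univ.erase i, (B' j).card : ℕ) : ℝ) ≤
      ((∏ j ∈ Finset.univ.erase i, (B j).card : ℕ) : ℝ) := by
    rw [Nat.cast_le]
    exact Finset.prod_le_prod' fun j _ => Finset.card_le_card (hsub j)
  rw [Nat.cast_mul, Nat.cast_mul] at h
  refine le_of_mul_le_mul_right ?_ hpos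
  calc _ = c * (((B i).card : ℝ) * _) := by ring
    _ ≤ _ := h
    _ ≤ _ := by gcongr

/-- Some class of a labelling with box classes is dense, and the average over it is hardly larger than
the average over the whole box. -/
theorem exists_dense_class [Nonempty ι] {Λ : Type*} [Fintype Λ] {tr : (∀ i, F i) → Λ} (htr : BoxLabel tr)
    {B : ∀ i, Finset (F i)} (hne : (Fintype.piFinset B).Nonempty) (g : Λ → (∀ i, F i) → ℝ)
    (hg : ∀ t f, 0 ≤ g t f) {c γ Q : ℝ} (hγ : 0 < γ) (hγ1 : γ < 1) (hQ : Fintype.card Λ ≤ Q)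
    (hc : boxAvg B (fun f => g (tr f) f) ≤ c) :
    ∃ (t : Λ) (B' : ∀ i, Finset (F i)), (∀ i, B' i ⊆ B i) ∧ (Fintype.piFinset B').Nonempty ∧
      boxAvg B' (g t) ≤ c / (1 - γ) ∧
      ∀ i, γ / Q * (B i).card ≤ (B' i).card := by
  classical
  have hBp : (0 : ℝ) < (Fintype.piFinset B).card := by exact_mod_cast hne.card_pos
  have hQ0 : 0 < Q := by
    obtain ⟨f, _⟩ := hne
    have : Nonempty Λ := ⟨tr f⟩
    exact lt_of_lt_of_le (by exact_mod_cast Fintype.card_pos) hQ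
  choose C hCB hC using htr.exists_box B
  have hCf : ∀ t, Fintype.piFinset (C t) = (Fintype.piFinset B).filter fun f => tr f = t := fun t => by
    ext f; rw [hC, Finset.mem_filter]
  have hcard : ∑ t, ((Fintype.piFinset (C t)).card : ℝ) = (Fintype.piFinset B).card := by
    simp only [hCf]
    exact_mod_cast (Finset.card_eq_sum_card_fiberwise
      (fun f _ => Finset.mem_coe.mpr (Finset.mem_univ (tr f)))).symm
  have hsum : ∑ t, ∑ f ∈ Fintype.piFinset (C t), g t f = ∑ f ∈ Fintype.piFinset B, g (tr f) f := by
    rw [← Finset.sum_fiberwise_of_maps_to (t := Finset.univ) (g := tr) fun _ _ => Finset.mem_univ _]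
    refine Finset.sum_congr rfl fun t _ => ?_
    rw [hCf]
    exact Finset.sum_congr rfl fun f hf => by rw [(Finset.mem_filter.mp hf).2]
  have hc' : ∑ f ∈ Fintype.piFinset B, g (tr f) f ≤ c * (Fintype.piFinset B).card := by
    rwa [boxAvg, div_le_iff₀ hBp] at hc
  have hc0 : 0 ≤ c := le_trans (div_nonneg (Finset.sum_nonneg fun f _ => hg _ _) hBp.le) hc
  let large : Finset Λ := Finset.univ.filter fun t =>
    γ / Q * (Fintype.piFinset B).card ≤ ((Fintype.piFinset (C t)).card : ℝ)
  have hlarge : (1 - γ) * (Fintype.piFinset B).card ≤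
      ∑ t ∈ large, ((Fintype.piFinset (C t)).card : ℝ) := by
    have h1 : ∑ t ∈ Finset.univ \ large, ((Fintype.piFinset (C t)).card : ℝ) ≤
        γ * (Fintype.piFinset B).card := by
      calc _ ≤ ∑ t ∈ Finset.univ \ large, γ / Q * (Fintype.piFinset B).card := by
            refine Finset.sum_le_sum fun t ht => ?_
            by_contra h
            exact (Finset.mem_sdiff.mp ht).2
              (Finset.mem_filter.mpr ⟨Finset.mem_univ _, (not_le.mp h).le⟩)
        _ ≤ ∑ t : Λ, γ / Q * (Fintype.piFinset B).card :=
            Finset.sum_le_univ_sum_of_nonneg fun _ => by positivity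
        _ = Fintype.card Λ * (γ / Q * (Fintype.piFinset B).card) := by simp
        _ ≤ Q * (γ / Q * (Fintype.piFinset B).card) := by gcongr
        _ = _ := by field_simp
    have h2 := Finset.sum_sdiff (f := fun t => ((Fintype.piFinset (C t)).card : ℝ))
      (Finset.subset_univ large)
    rw [hcard] at h2
    linarith
  have hlne : large.Nonempty := by
    rw [Finset.nonempty_iff_ne_empty]
    intro h
    rw [h, Finset.sum_empty] at hlarge
    have : 0 < (1 - γ) * (Fintype.piFinset B).card := mul_pos (by linarith) hBp
    linarith
  have hex : ∃ t ∈ large, ∑ f ∈ Fintype.piFinset (C t), g t f ≤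
      c / (1 - γ) * (Fintype.piFinset (C t)).card := by
    by_contra! h
    have h1 := Finset.sum_lt_sum_of_nonempty hlne h
    rw [← Finset.mul_sum] at h1
    have h2 : c * (Fintype.piFinset B).card ≤
        c / (1 - γ) * ∑ t ∈ large, ((Fintype.piFinset (C t)).card : ℝ) := by
      have h1γ : 0 < 1 - γ := by linarith
      calc _ = c / (1 - γ) * ((1 - γ) * (Fintype.piFinset B).card) := by field_simp
        _ ≤ _ := by gcongr
    have h3 : ∑ t ∈ large, ∑ f ∈ Fintype.piFinset (C t), g t f ≤
        ∑ t, ∑ f ∈ Fintype.piFinset (C t), g t f :=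
      Finset.sum_le_univ_sum_of_nonneg fun t => Finset.sum_nonneg fun f _ => hg _ _
    linarith
  obtain ⟨t, ht, hsumt⟩ := hex
  have hdense := (Finset.mem_filter.mp ht).2
  have hne' : (0 : ℝ) < (Fintype.piFinset (C t)).card := lt_of_lt_of_le (by positivity) hdense
  refine ⟨t, C t, hCB t, Finset.card_pos.mp (by exact_mod_cast hne'),
    ?_, dense_coordinate (hCB t) hne hdense⟩
  rwa [boxAvg, div_le_iff₀ hne']

theorem sum_piFinset_update [∀ i, DecidableEq (F i)] (B : ∀ i, Finset (F i)) (a : ι) (X : F a)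
    (k : (∀ i, F i) → ℝ) :
    ∑ f ∈ Fintype.piFinset B, k f =
      ∑ Y ∈ B a, ∑ f ∈ Fintype.piFinset (Function.update B a {X}), k (Function.update f a Y) := by
  rw [← Finset.sum_product']
  refine Finset.sum_nbij' (fun f => (f a, Function.update f a X))
    (fun p => Function.update p.2 a p.1) ?_ ?_ ?_ ?_ ?_
  · intro f hf
    rw [Finset.mem_product, Fintype.mem_piFinset]
    refine ⟨Fintype.mem_piFinset.mp hf a, fun i => ?_⟩
    rcases eq_or_ne i a with rfl | h
    · simp
    · simpa [h] using Fintype.mem_piFinset.mp hf i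
  · rintro ⟨Y, f⟩ hp
    rw [Finset.mem_product, Fintype.mem_piFinset] at hp
    rw [Fintype.mem_piFinset]
    intro i
    rcases eq_or_ne i a with rfl | h
    · simpa using hp.1
    · simpa [h] using hp.2 i
  · intro f _
    simp
  · rintro ⟨Y, f⟩ hp
    rw [Finset.mem_product, Fintype.mem_piFinset] at hp
    have : f a = X := by simpa using hp.2 a
    simp [← this]
  · intro f _
    simp

theorem boxAvg_update_singleton [∀ i, DecidableEq (F i)] {B : ∀ i, Finset (F i)}
    (a : ι) (ha : (B a).Nonempty) (X : F a)
    (g : (∀ i, F i) → ℝ) :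
    boxAvg (Function.update B a {X}) g = boxAvg B fun f => g (Function.update f a X) := by
  have hap : (0 : ℝ) < (B a).card := by exact_mod_cast ha.card_pos
  have h1 := sum_piFinset_update B a X fun f => g (Function.update f a X)
  have h2 := sum_piFinset_update B a X fun _ => 1
  have h3 : ∀ f ∈ Fintype.piFinset (Function.update B a {X}), Function.update f a X = f := by
    intro f hf
    have : f a = X := by simpa using Fintype.mem_piFinset.mp hf a
    simp [← this]
  simp only [Function.update_idem, Finset.sum_const, nsmul_eq_mul, mul_one] at h1 h2
  have h4 := Finset.sum_congr rfl fun f hf => congrArg g (h3 f hf)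
  unfold boxAvg
  rw [h1, h4, h2, mul_div_mul_left _ _ hap.ne']

theorem boxAvg_eq_sum_update [∀ i, DecidableEq (F i)] {B : ∀ i, Finset (F i)}
    (a : ι) (ha : (B a).Nonempty) (g : (∀ i, F i) → ℝ) :
    boxAvg B g = (∑ X ∈ B a, boxAvg B fun f => g (Function.update f a X)) / (B a).card := by
  have hap : (0 : ℝ) < (B a).card := by exact_mod_cast ha.card_pos
  obtain ⟨X, hX⟩ := ha
  have h2 := sum_piFinset_update B a X fun _ => 1
  simp only [Finset.sum_const, nsmul_eq_mul, mul_one] at h2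
  have h3 : ∀ Y, boxAvg B (fun f => g (Function.update f a Y)) =
      boxAvg (Function.update B a {X}) fun f => g (Function.update f a Y) := by
    intro Y
    rw [boxAvg_update_singleton a ⟨X, hX⟩]
    simp
  simp only [h3]
  unfold boxAvg
  rw [sum_piFinset_update B a X, h2, ← Finset.sum_div, div_div, mul_comm]

end Boxes

/-! ### Majority votes -/

section Majority

variable {Ω : Type*} [Fintype Ω]

/-- The fraction of the coins for which the verdict is not `s`. -/
noncomputable def wrongFrac (a : Ω → Bool) (s : Bool) : ℝ :=
  ((Finset.univ.filter fun ω => a ω ≠ s).card : ℝ) / Fintype.card Ω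

theorem wrongFrac_nonneg (a : Ω → Bool) (s : Bool) : 0 ≤ wrongFrac a s := by
  unfold wrongFrac; positivity

theorem wrongFrac_le_one (a : Ω → Bool) (s : Bool) : wrongFrac a s ≤ 1 := by
  unfold wrongFrac
  refine div_le_one_of_le₀ ?_ (by positivity)
  exact_mod_cast Finset.card_le_univ _

/-- The majority verdict of `k` runs. -/
def majority {k : ℕ} (a : Fin k → Bool) : Bool :=
  decide (k ≤ 2 * (Finset.univ.filter fun i => a i = true).card)

theorem two_mul_card_ne_majority_le {k : ℕ} (a : Fin k → Bool) :
    2 * (Finset.univ.filter fun i => a i ≠ majority a).card ≤ k := by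
  have h := Finset.card_filter_add_card_filter_not (s := Finset.univ) (fun i => a i = true)
  rw [Finset.card_univ, Fintype.card_fin] at h
  unfold majority
  by_cases hk : k ≤ 2 * (Finset.univ.filter fun i => a i = true).card
  · simp only [hk, decide_true, ne_eq]
    omega
  · simp only [hk, decide_false, ne_eq, Bool.not_eq_false]
    omega

/-- All of `k` independent runs err with probability `w ^ k`. -/
theorem card_forall_ne (a : Ω → Bool) (s : Bool) (k : ℕ) :
    ((Finset.univ.filter fun ρ : Fin k → Ω => ∀ i, a (ρ i) ≠ s).card : ℝ) =
      wrongFrac a s ^ k * (Fintype.card Ω : ℝ) ^ k := by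
  classical
  have : (Finset.univ.filter fun ρ : Fin k → Ω => ∀ i, a (ρ i) ≠ s) =
      Fintype.piFinset fun _ : Fin k => Finset.univ.filter fun ω => a ω ≠ s := by
    ext ρ; simp [Fintype.mem_piFinset]
  rw [this, Fintype.card_piFinset]
  simp only [Finset.prod_const, Finset.card_univ, Fintype.card_fin, Nat.cast_pow]
  rw [← mul_pow, wrongFrac]
  rcases isEmpty_or_nonempty Ω with h | h
  · simp
  · have : (Fintype.card Ω : ℝ) ≠ 0 := by exact_mod_cast Fintype.card_ne_zero
    rw [div_mul_cancel₀ _ this]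

/-- A bound on the number of runs that give the majority verdict `v`, by the exponential moment
of the number of dissenting runs. -/
theorem card_majority_eq_le (a : Ω → Bool) (v : Bool) (κ : ℕ) [Nonempty Ω] :
    ((Finset.univ.filter fun ρ : Fin (2 * κ) → Ω => majority (fun i => a (ρ i)) = v).card : ℝ) ≤
      3 ^ κ * ((1 - 2 / 3 * wrongFrac a v) * Fintype.card Ω) ^ (2 * κ) := by
  classical
  have hΩ : (Fintype.card Ω : ℝ) ≠ 0 := by exact_mod_cast Fintype.card_ne_zero
  have h1 : ∀ ρ : Fin (2 * κ) → Ω, (if majority (fun i => a (ρ i)) = v then (1 : ℝ) else 0) ≤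
      3 ^ κ * ∏ i, (if a (ρ i) ≠ v then (1 / 3 : ℝ) else 1) := by
    intro ρ
    split_ifs with h
    · rw [Finset.prod_ite, Finset.prod_const_one, mul_one, Finset.prod_const]
      have := two_mul_card_ne_majority_le fun i => a (ρ i)
      rw [h] at this
      calc (1 : ℝ) = 3 ^ κ * (1 / 3) ^ κ := by rw [← mul_pow]; norm_num
        _ ≤ _ := by
          refine mul_le_mul_of_nonneg_left ?_ (by positivity)
          exact pow_le_pow_of_le_one (by norm_num) (by norm_num) (by omega)
    · refine mul_nonneg (by positivity) (Finset.prod_nonneg fun i _ => ?_)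
      split_ifs <;> norm_num
  rw [Finset.card_filter, Nat.cast_sum]
  push_cast
  calc _ ≤ ∑ ρ : Fin (2 * κ) → Ω, 3 ^ κ * ∏ i, (if a (ρ i) ≠ v then (1 / 3 : ℝ) else 1) :=
        Finset.sum_le_sum fun ρ _ => h1 ρ
    _ = 3 ^ κ * ∏ _i : Fin (2 * κ), ∑ ω, (if a ω ≠ v then (1 / 3 : ℝ) else 1) := by
        rw [← Finset.mul_sum, Finset.prod_univ_sum, Fintype.piFinset_univ]
    _ = _ := by
        rw [Finset.prod_const, Finset.card_univ, Fintype.card_fin]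
        congr 2
        have h2 : ∀ ω, (if a ω ≠ v then (1 / 3 : ℝ) else 1) =
            1 - 2 / 3 * (if a ω ≠ v then 1 else 0) := by
          intro ω; split_ifs <;> norm_num
        simp only [h2, Finset.sum_sub_distrib, ← Finset.mul_sum, Finset.sum_boole, wrongFrac]
        simp only [Finset.sum_const, Finset.card_univ, nsmul_eq_mul, mul_one]
        field_simp

/-- The expected weight `(3w/2)^k` of the majority verdict is small, for every acceptance
probability: if the verdict errs with probability near `3/4`, majorities for it are rare. -/
theorem sum_majority_le (a : Ω → Bool) (κ : ℕ) [Nonempty Ω] :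
    ∑ ρ : Fin (28 * κ) → Ω, (3 / 2 * wrongFrac a (majority fun i => a (ρ i))) ^ (28 * κ) ≤
      2 * (1 / 2) ^ κ * (Fintype.card Ω : ℝ) ^ (28 * κ) := by
  classical
  have hv : ∀ v : Bool, ∑ ρ : Fin (28 * κ) → Ω,
      (if majority (fun i => a (ρ i)) = v then (3 / 2 * wrongFrac a v) ^ (28 * κ) else 0) ≤
      (1 / 2) ^ κ * (Fintype.card Ω : ℝ) ^ (28 * κ) := by
    intro v
    set w := wrongFrac a v with hw
    have hw0 : 0 ≤ w := wrongFrac_nonneg a v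
    have hw1 : w ≤ 1 := wrongFrac_le_one a v
    have hb := card_majority_eq_le a v (14 * κ)
    rw [show 2 * (14 * κ) = 28 * κ by ring, ← hw] at hb
    rw [← Finset.sum_filter, Finset.sum_const, nsmul_eq_mul]
    have hq0 : 0 ≤ w * (1 - 2 / 3 * w) := mul_nonneg hw0 (by linarith)
    have hq : w * (1 - 2 / 3 * w) ≤ 3 / 8 := by nlinarith [sq_nonneg (w - 3 / 4)]
    calc _ ≤ 3 ^ (14 * κ) * ((1 - 2 / 3 * w) * Fintype.card Ω) ^ (28 * κ) *
          (3 / 2 * w) ^ (28 * κ) := by gcongr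
      _ = ((27 / 4 * (w * (1 - 2 / 3 * w)) ^ 2) ^ 14) ^ κ * (Fintype.card Ω : ℝ) ^ (28 * κ) := by
          rw [← pow_mul, mul_pow (27 / 4 : ℝ), ← pow_mul, show (27 / 4 : ℝ) = 3 * (3 / 2) ^ 2 by norm_num,
            mul_pow (3 : ℝ), ← pow_mul, show 2 * (14 * κ) = 28 * κ by ring]
          rw [mul_pow, mul_pow, mul_pow]
          ring
      _ ≤ ((27 / 4 * (3 / 8) ^ 2) ^ 14) ^ κ * (Fintype.card Ω : ℝ) ^ (28 * κ) := by gcongr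
      _ ≤ _ := by gcongr; norm_num
  have hsplit : ∀ ρ : Fin (28 * κ) → Ω,
      (3 / 2 * wrongFrac a (majority fun i => a (ρ i))) ^ (28 * κ) =
      (if majority (fun i => a (ρ i)) = true then (3 / 2 * wrongFrac a true) ^ (28 * κ) else 0) +
      (if majority (fun i => a (ρ i)) = false then (3 / 2 * wrongFrac a false) ^ (28 * κ) else 0) := by
    intro ρ
    cases h : majority (fun i => a (ρ i)) <;> simp
  simp only [hsplit, Finset.sum_add_distrib]
  linarith [hv true, hv false]

end Majority

/-! ### Planting an encoded string -/

section Plant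

variable {H : ℕ} {Row X : ℕ → Type}

/-- An assignment of the two half-tables of every stage: a row address and an input are sent to a bit. -/
abbrev HalfTable {H : ℕ} (Row X : ℕ → Type) (p : Fin H × Bool) : Type := Row p.1 → X p.1 → Bool

theorem BoxLabel.rectLabel {Λ : Type*} {tr : (∀ p : Fin H × Bool, HalfTable Row X p) → Λ}
    (h : BoxLabel tr) (f : ∀ p : Fin H × Bool, HalfTable Row X p) (j : Fin H) :
    RectLabel fun (x y : Row j → X j → Bool) =>
      tr (Function.update (Function.update f (j, false) x) (j, true) y) := by
  intro x x' y y' hxy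
  have := h _ _ {(j, false)} hxy
  simp only at hxy ⊢
  rw [← this]
  congr 1
  funext p
  by_cases h1 : p = (j, false)
  · subst h1; simp [Finset.piecewise]
  · by_cases h2 : p = (j, true)
    · subst h2; simp [Finset.piecewise]
    · simp [Finset.piecewise, h1, h2]

variable [∀ h, Fintype (Row h)] [∀ h, Fintype (X h)] [∀ h, DecidableEq (Row h)]
  [∀ h, DecidableEq (X h)] [∀ h, Nonempty (Row h)]

/-- In a dense box one can plant the string `s` as the exclusive or of two rows with the same address,
so that a sum of functions of box labels hardly grows on average. -/
theorem exists_planted {W : Type*} [Fintype W] {Λ : W → Type*} [∀ w, Fintype (Λ w)]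
    (tr : ∀ w, (∀ p : Fin H × Bool, HalfTable Row X p) → Λ w) (htr : ∀ w, BoxLabel (tr w))
    (G : ∀ w, Λ w → ℝ) (β : W → ℝ) (hG : ∀ w l, 0 ≤ G w l) (hGβ : ∀ w l, G w l ≤ β w)
    {δ D ℓ d : ℝ} (hδ : 0 < δ) (hδ1 : δ ≤ 1 / 16) (hD : 0 ≤ D) (hℓ : 0 ≤ ℓ) (hd : 0 ≤ d)
    (hδd : 1 ≤ δ * (2 : ℝ) ^ d) (hΛ : ∀ w, (Fintype.card (Λ w) : ℝ) ≤ (2 : ℝ) ^ ℓ)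
    (j : Fin H) (hR : 2 * (D + ℓ + d) ≤ Fintype.card (Row j) * δ ^ 6)
    (B : ∀ p : Fin H × Bool, Finset (HalfTable Row X p)) (hB : ∀ p, (B p).Nonempty)
    (hdB : ∀ b, (Fintype.card (X j → Bool) : ℝ) ^ Fintype.card (Row j) ≤
      (B (j, b)).card * (2 : ℝ) ^ D)
    (s : X j → Bool) :
    ∃ (r : Row j) (x y : Row j → X j → Bool), x ∈ B (j, false) ∧ y ∈ B (j, true) ∧
      (∀ z, xor (x r z) (y r z) = s z) ∧
      boxAvg (Function.update (Function.update B (j, false) {x}) (j, true) {y})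
        (fun f => ∑ w, G w (tr w f)) ≤
      (boxAvg B (fun f => ∑ w, G w (tr w f)) + 8 * δ * ∑ w, β w) / (1 - 8 * δ) := by
  classical
  set 𝒳 : Finset (Row j → X j → Bool) := B (j, false) with h𝒳
  set 𝒴 : Finset (Row j → X j → Bool) := B (j, true) with h𝒴
  have h𝒳ne : 𝒳.Nonempty := hB _
  have h𝒴ne : 𝒴.Nonempty := hB _
  have hBne : (Fintype.piFinset B).Nonempty := Fintype.piFinset_nonempty.mpr hB
  have h𝒳p : (0 : ℝ) < 𝒳.card := by exact_mod_cast h𝒳ne.card_pos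
  have h𝒴p : (0 : ℝ) < 𝒴.card := by exact_mod_cast h𝒴ne.card_pos
  have hBp : (0 : ℝ) < (Fintype.piFinset B).card := by exact_mod_cast hBne.card_pos
  let π : Equiv.Perm (X j → Bool) :=
    Function.Involutive.toPerm (fun u z => xor (s z) (u z)) fun u => by
      funext z; simp
  let up : (Row j → X j → Bool) → (Row j → X j → Bool) →
      (∀ p : Fin H × Bool, HalfTable Row X p) → ∀ p : Fin H × Bool, HalfTable Row X p :=
    fun x y f => Function.update (Function.update f (j, false) x) (j, true) y
  let φ : (∀ p : Fin H × Bool, HalfTable Row X p) → ℝ := fun f => ∑ w, G w (tr w f)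
  let ψ : (Row j → X j → Bool) → (Row j → X j → Bool) → ℝ := fun x y =>
    boxAvg B fun f => φ (up x y f)
  have hψ : boxAvg B φ = (∑ x ∈ 𝒳, ∑ y ∈ 𝒴, ψ x y) / (𝒳.card * 𝒴.card) := by
    have h1 : ∀ y, boxAvg B (fun f => φ (Function.update f (j, true) y)) =
        (∑ x ∈ 𝒳, ψ x y) / 𝒳.card := fun y => boxAvg_eq_sum_update (j, false) (hB _) _
    rw [boxAvg_eq_sum_update (j, true) (hB _), Finset.sum_congr rfl fun y _ => h1 y,
      ← Finset.sum_div, div_div, Finset.sum_comm]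
  have hmain : ∀ w f, (∑ x ∈ 𝒳, ∑ y ∈ 𝒴, (β w - G w (tr w (up x y f)))) / (𝒳.card * 𝒴.card) -
      8 * δ * β w ≤ plantAvg 𝒳 𝒴 π fun x y => β w - G w (tr w (up x y f)) := by
    intro w f
    exact uniform_le_plantAvg (fun x y => tr w (up x y f)) ((htr w).rectLabel f j)
      (fun l => β w - G w l) (B := β w) (fun l => sub_nonneg.mpr (hGβ w l))
      (fun l => by linarith [hG w l]) hδ (by linarith) hD hℓ hd hδd (hΛ w) hR 𝒳 𝒴 h𝒳ne h𝒴ne π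
      (hdB false) (hdB true)
  have hmass : 1 - 8 * δ ≤ plantAvg 𝒳 𝒴 π fun _ _ => 1 := by
    have h := uniform_le_plantAvg (fun _ _ : Row j → X j → Bool => ()) (fun _ _ _ _ _ => rfl)
      (fun _ => 1) (B := 1) (fun _ => zero_le_one) (fun _ => le_rfl) hδ (by linarith) hD hℓ hd hδd
      (by simpa using Real.one_le_rpow (by norm_num : (1 : ℝ) ≤ 2) hℓ) hR 𝒳 𝒴 h𝒳ne h𝒴ne π
      (hdB false) (hdB true)
    have e : (∑ x ∈ 𝒳, ∑ y ∈ 𝒴, (1 : ℝ)) / (𝒳.card * 𝒴.card) = 1 := by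
      simp only [Finset.sum_const, nsmul_eq_mul, mul_one]
      field_simp
    rw [e] at h
    linarith
  have hcompl : ∀ x y, (∑ w, β w) - ψ x y =
      ((Fintype.piFinset B).card : ℝ)⁻¹ *
        ∑ f ∈ Fintype.piFinset B, ∑ w, (β w - G w (tr w (up x y f))) := by
    intro x y
    simp only [Finset.sum_sub_distrib, Finset.sum_const, nsmul_eq_mul]
    simp only [ψ, boxAvg, φ]
    field_simp
  have hsum : (∑ w, β w) - boxAvg B φ - 8 * δ * ∑ w, β w ≤
      plantAvg 𝒳 𝒴 π fun x y => (∑ w, β w) - ψ x y := by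
    have e1 : (∑ w, β w) - boxAvg B φ =
        (∑ x ∈ 𝒳, ∑ y ∈ 𝒴, ((∑ w, β w) - ψ x y)) / (𝒳.card * 𝒴.card) := by
      rw [hψ]
      simp only [Finset.sum_sub_distrib, Finset.sum_const, nsmul_eq_mul]
      field_simp
    rw [e1]
    simp only [hcompl, plantAvg_const_mul, plantAvg_sum]
    have e2 : (∑ x ∈ 𝒳, ∑ y ∈ 𝒴, ((Fintype.piFinset B).card : ℝ)⁻¹ *
        ∑ f ∈ Fintype.piFinset B, ∑ w, (β w - G w (tr w (up x y f)))) / (𝒳.card * 𝒴.card) =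
        ((Fintype.piFinset B).card : ℝ)⁻¹ * ∑ f ∈ Fintype.piFinset B, ∑ w,
          (∑ x ∈ 𝒳, ∑ y ∈ 𝒴, (β w - G w (tr w (up x y f)))) / (𝒳.card * 𝒴.card) := by
      simp_rw [← Finset.mul_sum, mul_div_assoc, ← Finset.sum_div]
      congr 2
      rw [Finset.sum_congr rfl fun x _ => Finset.sum_comm, Finset.sum_comm]
      refine Finset.sum_congr rfl fun f _ => ?_
      rw [Finset.sum_congr rfl fun x _ => Finset.sum_comm, Finset.sum_comm]
    have e3 : 8 * δ * ∑ w, β w = ((Fintype.piFinset B).card : ℝ)⁻¹ *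
        ∑ f ∈ Fintype.piFinset B, ∑ w, 8 * δ * β w := by
      rw [Finset.sum_const, nsmul_eq_mul, Finset.mul_sum]
      field_simp
    rw [e2, e3, ← mul_sub, ← Finset.sum_sub_distrib]
    refine mul_le_mul_of_nonneg_left (Finset.sum_le_sum fun f _ => ?_) (by positivity)
    rw [← Finset.sum_sub_distrib]
    exact Finset.sum_le_sum fun w _ => hmain w f
  have hβ : 0 ≤ ∑ w, β w := by
    refine Finset.sum_nonneg fun w _ => ?_
    obtain ⟨f, _⟩ := hBne
    exact (hG w (tr w f)).trans (hGβ w _)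
  have hupper : plantAvg 𝒳 𝒴 π ψ ≤ boxAvg B φ + 8 * δ * ∑ w, β w := by
    have h1 : plantAvg 𝒳 𝒴 π (fun x y => (∑ w, β w) - ψ x y) =
        (∑ w, β w) * plantAvg 𝒳 𝒴 π (fun _ _ => 1) - plantAvg 𝒳 𝒴 π ψ := by
      rw [← plantAvg_const_mul, eq_sub_iff_add_eq, ← plantAvg_add]
      simp
    rw [h1] at hsum
    have := mul_le_mul_of_nonneg_left (plantAvg_one_le 𝒳 𝒴 π) hβ
    linarith
  -- the planted pairs
  let P : Finset (Row j × (Row j → X j → Bool) × (Row j → X j → Bool)) :=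
    Finset.univ.filter fun p => p.2.1 ∈ 𝒳 ∧ p.2.2 ∈ 𝒴 ∧ p.2.2 p.1 = π (p.2.1 p.1)
  have hPne : P.Nonempty := by
    by_contra h
    have h0 : plantAvg 𝒳 𝒴 π (fun _ _ => 1) ≤ plantAvg 𝒳 𝒴 π (fun _ _ => 0 * 1) := by
      refine plantAvg_mono 𝒳 𝒴 π fun i x hx y hy hxy => absurd ?_ h
      exact ⟨(i, x, y), Finset.mem_filter.mpr ⟨Finset.mem_univ _, hx, hy, hxy⟩⟩
    rw [plantAvg_const_mul] at h0
    linarith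
  obtain ⟨⟨r, x, y⟩, hp, hmin⟩ := P.exists_min_image (fun p => ψ p.2.1 p.2.2) hPne
  obtain ⟨-, hx, hy, hxy⟩ := Finset.mem_filter.mp hp
  simp only at hx hy hxy hmin
  refine ⟨r, x, y, hx, hy, fun z => ?_, ?_⟩
  · rw [hxy]
    change xor (x r z) (xor (s z) (x r z)) = s z
    cases s z <;> cases x r z <;> rfl
  · have e : boxAvg (Function.update (Function.update B (j, false) {x}) (j, true) {y}) φ =
        ψ x y := by
      rw [boxAvg_update_singleton (j, true) (by simpa using hB (j, true)),
        boxAvg_update_singleton (j, false) (hB _)]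
    change boxAvg _ φ ≤ (boxAvg B φ + _) / _
    rw [e, le_div_iff₀ (by linarith)]
    refine le_trans ?_ hupper
    have h1 : ψ x y * plantAvg 𝒳 𝒴 π (fun _ _ => 1) ≤ plantAvg 𝒳 𝒴 π ψ := by
      rw [← plantAvg_const_mul]
      refine plantAvg_mono 𝒳 𝒴 π fun i x' hx' y' hy' hxy' => ?_
      rw [mul_one]
      exact hmin (i, x', y') (Finset.mem_filter.mpr ⟨Finset.mem_univ _, hx', hy', hxy'⟩)
    have hψ0 : 0 ≤ ψ x y :=
      div_nonneg (Finset.sum_nonneg fun f _ => Finset.sum_nonneg fun w _ => hG w _) hBp.le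
    exact le_trans (mul_le_mul_of_nonneg_left hmass hψ0) h1

end Plant

/-! ### All stages together -/

section Stages

variable {H : ℕ} {Row X Ω Lab : ℕ → Type} [∀ h, Fintype (X h)] [∀ h, Fintype (Ω h)]

/-- The number of runs that are put to a vote at stage `h`. -/
def numRuns (h : ℕ) : ℕ := 28 * (6 * (h + 1))

/-- The potential of stage `h` for the outcomes `s`: every input `x` contributes `(3w/2)^k`, where `w` is
the probability of a verdict other than `s x` and `k` is the number of runs.  It is at least one if some
outcome is wrong with probability `2/3`. -/
noncomputable def stagePotential (tr : ∀ h, X h → Ω h → (∀ p : Fin H × Bool, HalfTable Row X p) → Lab h)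
    (acc : ∀ h, X h → Ω h → Lab h → Bool) (h : ℕ) (s : X h → Bool)
    (f : ∀ p : Fin H × Bool, HalfTable Row X p) : ℝ :=
  ∑ x, (3 / 2 * wrongFrac (fun ω => acc h x ω (tr h x ω f)) (s x)) ^ numRuns h

variable (tr : ∀ h, X h → Ω h → (∀ p : Fin H × Bool, HalfTable Row X p) → Lab h)
  (acc : ∀ h, X h → Ω h → Lab h → Bool)

theorem stagePotential_nonneg (h : ℕ) (s : X h → Bool)
    (f : ∀ p : Fin H × Bool, HalfTable Row X p) : 0 ≤ stagePotential tr acc h s f :=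
  Finset.sum_nonneg fun x _ => pow_nonneg (mul_nonneg (by norm_num) (wrongFrac_nonneg _ _)) _

theorem wrongFrac_lt_of_stagePotential_lt_one {h : ℕ} {s : X h → Bool}
    {f : ∀ p : Fin H × Bool, HalfTable Row X p} (hf : stagePotential tr acc h s f < 1) (x : X h) :
    wrongFrac (fun ω => acc h x ω (tr h x ω f)) (s x) < 2 / 3 := by
  by_contra! hw
  have h1 : (1 : ℝ) ≤ (3 / 2 * wrongFrac (fun ω => acc h x ω (tr h x ω f)) (s x)) ^ numRuns h :=
    one_le_pow₀ (by linarith)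
  have h2 := Finset.single_le_sum (f := fun x =>
    (3 / 2 * wrongFrac (fun ω => acc h x ω (tr h x ω f)) (s x)) ^ numRuns h)
    (fun x _ => pow_nonneg (mul_nonneg (by norm_num) (wrongFrac_nonneg _ _)) _) (Finset.mem_univ x)
  exact absurd (h1.trans h2) (not_le.mpr hf)

/-- The outcomes of stage `h` by majority, read off the labels of the runs. -/
def voteOutcome (h : ℕ) (ρ : Fin (numRuns h) → Ω h) (t : X h → Fin (numRuns h) → Lab h) :
    X h → Bool :=
  fun x => majority fun i => acc h x (ρ i) (t x i)

variable [∀ h, Nonempty (Ω h)]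

/-- Some coins make the majority outcomes good on average. -/
theorem exists_coins (h : ℕ) (B : ∀ p : Fin H × Bool, Finset (HalfTable Row X p))
    (φ : (∀ p : Fin H × Bool, HalfTable Row X p) → ℝ) (hB : (Fintype.piFinset B).Nonempty) :
    ∃ ρ : Fin (numRuns h) → Ω h,
      boxAvg B (fun f => φ f + stagePotential tr acc h
        (voteOutcome acc h ρ fun x i => tr h x (ρ i) f) f) ≤
      boxAvg B φ + Fintype.card (X h) * (2 * (1 / 2) ^ (6 * (h + 1))) := by
  classical
  set c := boxAvg B φ + Fintype.card (X h) * (2 * (1 / 2) ^ (6 * (h + 1))) with hc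
  have hpt : ∀ f, ∑ ρ : Fin (numRuns h) → Ω h, stagePotential tr acc h
      (voteOutcome acc h ρ fun x i => tr h x (ρ i) f) f ≤
      Fintype.card (X h) * (2 * (1 / 2) ^ (6 * (h + 1))) *
        Fintype.card (Fin (numRuns h) → Ω h) := by
    intro f
    simp only [stagePotential, voteOutcome]
    rw [Finset.sum_comm]
    calc _ ≤ ∑ x : X h, 2 * (1 / 2) ^ (6 * (h + 1)) * (Fintype.card (Ω h) : ℝ) ^ numRuns h :=
          Finset.sum_le_sum fun x _ =>
            sum_majority_le (fun ω => acc h x ω (tr h x ω f)) (6 * (h + 1))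
      _ = _ := by
          rw [Finset.sum_const, Finset.card_univ, nsmul_eq_mul, Fintype.card_fun, Fintype.card_fin]
          push_cast
          ring
  have hsum : ∑ ρ : Fin (numRuns h) → Ω h, boxAvg B (fun f => φ f + stagePotential tr acc h
        (voteOutcome acc h ρ fun x i => tr h x (ρ i) f) f) ≤
      ∑ _ρ : Fin (numRuns h) → Ω h, c := by
    rw [← boxAvg_sum]
    simp only [Finset.sum_add_distrib, Finset.sum_const, Finset.card_univ, nsmul_eq_mul]
    rw [boxAvg_add]
    have h1 : boxAvg B (fun f => (Fintype.card (Fin (numRuns h) → Ω h) : ℝ) * φ f) =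
        Fintype.card (Fin (numRuns h) → Ω h) * boxAvg B φ := by
      simp only [boxAvg, ← Finset.mul_sum, mul_div_assoc]
    have h2 := boxAvg_mono B fun f _ => hpt f
    rw [boxAvg_const hB] at h2
    rw [h1, hc]
    linarith
  obtain ⟨ρ, -, hρ⟩ := Finset.exists_le_of_sum_le Finset.univ_nonempty hsum
  exact ⟨ρ, hρ⟩

/-- The potentials of the stages up to `j` as a sum of functions of box labels: `w ^ k` is the
probability that `k` fresh runs all err. -/
theorem sum_stagePotential_eq (j : ℕ) (s : ∀ h, X h → Bool)
    (f : ∀ p : Fin H × Bool, HalfTable Row X p) :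
    ∑ h ∈ Finset.range (j + 1), stagePotential tr acc h (s h) f =
      ∑ w : Σ h : Fin (j + 1), X h × (Fin (numRuns h) → Ω h),
        (if ∀ i, acc w.1 w.2.1 (w.2.2 i) (tr w.1 w.2.1 (w.2.2 i) f) ≠ s w.1 w.2.1 then
          (3 / 2 : ℝ) ^ numRuns w.1 / (Fintype.card (Ω w.1) : ℝ) ^ numRuns w.1 else 0) := by
  classical
  rw [Finset.sum_range, Fintype.sum_sigma]
  refine Finset.sum_congr rfl fun h _ => ?_
  rw [Fintype.sum_prod_type]
  refine Finset.sum_congr rfl fun x _ => ?_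
  have hΩ : (Fintype.card (Ω h) : ℝ) ≠ 0 := by exact_mod_cast Fintype.card_ne_zero
  change _ = ∑ ρ : Fin (numRuns h) → Ω h,
    (if ∀ i, acc h x (ρ i) (tr h x (ρ i) f) ≠ s h x then
      (3 / 2 : ℝ) ^ numRuns h / (Fintype.card (Ω h) : ℝ) ^ numRuns h else 0)
  rw [← Finset.sum_filter, Finset.sum_const, nsmul_eq_mul,
    card_forall_ne (fun ω => acc h x ω (tr h x ω f)) (s h x) (numRuns h), mul_pow]
  field_simp

/-- A bound on the sum of the largest values of the functions in `sum_stagePotential_eq`. -/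
theorem sum_weights_le (hX : ∀ h, Fintype.card (X h) ≤ 2 ^ (h + 1)) (j : ℕ) :
    ∑ w : Σ h : Fin (j + 1), X h × (Fin (numRuns h) → Ω h),
      (3 / 2 : ℝ) ^ numRuns w.1 / (Fintype.card (Ω w.1) : ℝ) ^ numRuns w.1 ≤
      (2 : ℝ) ^ (170 * (j + 1)) := by
  classical
  rw [Fintype.sum_sigma]
  have h1 : ∀ h : Fin (j + 1), ∑ w : X h × (Fin (numRuns h) → Ω h),
      (3 / 2 : ℝ) ^ numRuns h / (Fintype.card (Ω h) : ℝ) ^ numRuns h ≤ (2 : ℝ) ^ (169 * (j + 1)) := by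
    intro h
    have hΩ : (Fintype.card (Ω h) : ℝ) ≠ 0 := by exact_mod_cast Fintype.card_ne_zero
    have hh : (h : ℕ) ≤ j := Nat.lt_succ_iff.mp h.2
    rw [Finset.sum_const, Finset.card_univ, Fintype.card_prod, Fintype.card_fun, Fintype.card_fin,
      nsmul_eq_mul]
    push_cast
    calc _ = (Fintype.card (X h) : ℝ) * (3 / 2) ^ numRuns h := by field_simp
      _ ≤ 2 ^ (j + 1) * 2 ^ (168 * (j + 1)) := by
          have e1 : (Fintype.card (X h) : ℝ) ≤ 2 ^ (j + 1) := by
            have := (hX h).trans (Nat.pow_le_pow_right two_pos (Nat.succ_le_succ hh))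
            exact_mod_cast this
          have e2 : (3 / 2 : ℝ) ^ numRuns h ≤ 2 ^ (168 * (j + 1)) := by
            calc (3 / 2 : ℝ) ^ numRuns h ≤ 2 ^ numRuns h := by gcongr; norm_num
              _ ≤ _ := by
                refine pow_le_pow_right₀ (by norm_num) ?_
                unfold numRuns; omega
          gcongr
      _ = _ := by exact (pow_add _ _ _).symm.trans (congrArg _ (by ring))
  calc _ ≤ ∑ _h : Fin (j + 1), (2 : ℝ) ^ (169 * (j + 1)) := Finset.sum_le_sum fun h _ => h1 h
    _ = (j + 1) * (2 : ℝ) ^ (169 * (j + 1)) := by simp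
    _ ≤ 2 ^ (j + 1) * (2 : ℝ) ^ (169 * (j + 1)) := by
        gcongr
        exact_mod_cast (Nat.lt_two_pow_self (n := j + 1)).le
    _ = _ := by exact (pow_add _ _ _).symm.trans (congrArg _ (by ring))

variable [∀ h, Fintype (Row h)] [∀ h, DecidableEq (Row h)] [∀ h, DecidableEq (X h)]
  [∀ h, Nonempty (Row h)] [∀ h, Fintype (Lab h)]

/-- A box of assignments after the stages before `j` have been dealt with: their outcomes `s` are encoded
in the rows `r`, the tables of the other stages are still dense, and the potential is small on
average. -/
structure StageBox (j : ℕ) where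
  box : ∀ p : Fin H × Bool, Finset (HalfTable Row X p)
  outcome : ∀ h, X h → Bool
  row : ∀ h, Row h
  nonempty : ∀ p, (box p).Nonempty
  encoded : ∀ h : Fin H, (h : ℕ) < j → ∀ f ∈ Fintype.piFinset box, ∀ x,
    xor (f (h, false) (row h) x) (f (h, true) (row h) x) = outcome h x
  dense : ∀ p : Fin H × Bool, j ≤ p.1 → (Fintype.card (X p.1 → Bool) : ℝ) ^ Fintype.card (Row p.1) ≤
    (box p).card * (2 : ℝ) ^ ((2 ^ (14 * j) : ℕ) : ℝ)
  potential_le : boxAvg box (fun f =>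
    ∑ h ∈ Finset.range j, stagePotential tr acc h (outcome h) f) ≤ (1 - (1 / 2) ^ j) / 2

/-- The losses of a step fit into the budget: a step adds `2 e` by its own potential and divides by
`1 - γ` when the labels are fixed, and planting adds `b` and divides by `1 - t`. -/
theorem budget_step {n : ℕ} (hn : 1 ≤ n) {E : ℝ} (hE : E ≤ (1 - (1 / 2) ^ (n - 1)) / 2) {e : ℝ}
    (he : e = (1 / 2) ^ (5 * n)) {γ b t : ℝ} (hγ : γ ≤ e / 2) (hb : b ≤ e) (ht : t ≤ e) (ht0 : 0 ≤ t)
    (hE0 : 0 ≤ E) :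
    ((E + 2 * e) / (1 - γ) + b) / (1 - t) ≤ (1 - (1 / 2) ^ n) / 2 := by
  have he0 : 0 < e := by rw [he]; positivity
  have he1 : e ≤ 1 / 32 := by
    rw [he]
    calc (1 / 2 : ℝ) ^ (5 * n) ≤ (1 / 2) ^ 5 :=
          pow_le_pow_of_le_one (by norm_num) (by norm_num) (by omega)
      _ = 1 / 32 := by norm_num
  have hE1 : E ≤ 1 / 2 := by
    have : (0 : ℝ) ≤ (1 / 2) ^ (n - 1) := by positivity
    linarith
  have h1 : (E + 2 * e) / (1 - γ) ≤ E + 3 * e := by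
    rw [div_le_iff₀ (by linarith)]
    nlinarith
  have h2 : ((E + 2 * e) / (1 - γ) + b) / (1 - t) ≤ E + 6 * e := by
    rw [div_le_iff₀ (by linarith)]
    nlinarith
  have h3 : 6 * e ≤ (1 / 2) ^ n / 2 := by
    have h4 : e = (1 / 2) ^ (4 * n) * (1 / 2) ^ n := by rw [he, ← pow_add]; congr 1; ring
    have h5 : (1 / 2 : ℝ) ^ (4 * n) ≤ (1 / 2) ^ 4 :=
      pow_le_pow_of_le_one (by norm_num) (by norm_num) (by omega)
    rw [h4]
    have : (0 : ℝ) ≤ (1 / 2) ^ n := by positivity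
    nlinarith
  have h6 : (1 / 2 : ℝ) ^ (n - 1) = 2 * (1 / 2) ^ n := by
    obtain ⟨m, rfl⟩ : ∃ m, n = m + 1 := ⟨n - 1, by omega⟩
    rw [Nat.add_sub_cancel, pow_succ]; ring
  rw [h6] at hE
  linarith

theorem card_labels_le {A : Type*} [Fintype A] {n k m : ℕ} (hA : Fintype.card A ≤ 2 ^ n) (hk : k ≤ m) :
    Fintype.card (Fin k → A) ≤ 2 ^ (n * m) := by
  rw [Fintype.card_fun, Fintype.card_fin]
  refine (Nat.pow_le_pow_left hA k).trans ?_
  rw [← pow_mul]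
  exact Nat.pow_le_pow_right two_pos (Nat.mul_le_mul_left _ hk)

theorem numRuns_le (h : ℕ) : numRuns h ≤ 2 ^ (8 * (h + 1)) := by
  have h1 : h + 1 ≤ 2 ^ h := Nat.lt_two_pow_self
  calc numRuns h = 168 * (h + 1) := by unfold numRuns; ring
    _ ≤ 2 ^ 8 * 2 ^ h := Nat.mul_le_mul (by norm_num) h1
    _ = 2 ^ (8 + h) := (pow_add _ _ _).symm
    _ ≤ _ := Nat.pow_le_pow_right two_pos (by omega)

set_option maxHeartbeats 1000000 in
/-- One more stage: fix coins for which the majority outcomes are good on average, restrict the box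
to assignments on which the sampled runs have given labels, so that the outcomes are fixed, and plant these
outcomes in the half-tables of the stage. -/
theorem exists_stageBox_succ (htr : ∀ h x ω, BoxLabel (tr h x ω))
    (hX : ∀ h, Fintype.card (X h) ≤ 2 ^ (h + 1))
    (hLab : ∀ h, Fintype.card (Lab h) ≤ 2 ^ 2 ^ (4 * (h + 1)))
    (hRow : ∀ h, 2 ^ (1100 * (h + 1)) ≤ Fintype.card (Row h)) (j : Fin H)
    (S : StageBox tr acc j) : Nonempty (StageBox tr acc (j + 1)) := by
  classical
  obtain ⟨B, s, r, hBne, henc, hdense, hpot⟩ := S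
  have : Nonempty (Fin H × Bool) := ⟨(j, true)⟩
  have hB : (Fintype.piFinset B).Nonempty := Fintype.piFinset_nonempty.mpr hBne
  obtain ⟨n, hn⟩ : ∃ n : ℕ, n = j + 1 := ⟨_, rfl⟩
  have hn1 : 1 ≤ n := by omega
  obtain ⟨e, he⟩ : ∃ e : ℝ, e = (1 / 2) ^ (5 * n) := ⟨_, rfl⟩
  obtain ⟨γ, hγ⟩ : ∃ γ : ℝ, γ = (1 / 2) ^ (6 * n) := ⟨_, rfl⟩
  obtain ⟨δ, hδ⟩ : ∃ δ : ℝ, δ = (1 / 2) ^ (180 * n) := ⟨_, rfl⟩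
  obtain ⟨E, hE⟩ : ∃ E : ℝ, E = boxAvg B (fun f =>
    ∑ h ∈ Finset.range j, stagePotential tr acc h (s h) f) := ⟨_, rfl⟩
  have hE0 : 0 ≤ E := by
    rw [hE, ← boxAvg_const hB 0]
    exact boxAvg_mono B fun f _ => Finset.sum_nonneg fun h _ => stagePotential_nonneg _ _ _ _ _
  rw [← hE] at hpot
  -- fix the coins of stage `j`, and then the labels of its runs
  obtain ⟨ρ, hρ⟩ := exists_coins tr acc j B (fun f =>
    ∑ h ∈ Finset.range j, stagePotential tr acc h (s h) f) hB
  rw [← hE] at hρ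
  have hη : (Fintype.card (X j) : ℝ) * (2 * (1 / 2) ^ (6 * ((j : ℕ) + 1))) ≤ 2 * e := by
    have h1 : (Fintype.card (X j) : ℝ) ≤ 2 ^ n := by rw [hn]; exact_mod_cast hX j
    rw [← hn]
    calc _ ≤ (2 : ℝ) ^ n * (2 * (1 / 2) ^ (6 * n)) := by gcongr
      _ = 2 * e := by
        rw [he, show 6 * n = n + 5 * n by ring, pow_add, one_div, inv_pow]
        field_simp
  have hρ' := hρ.trans (show _ ≤ E + 2 * e by linarith)
  have hcard : (Fintype.card (X j → Fin (numRuns j) → Lab j) : ℝ) ≤ (2 : ℝ) ^ ((2 ^ (13 * n) : ℕ) : ℝ) := by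
    have h1 := card_labels_le (hLab j) (numRuns_le j)
    have h2 : Fintype.card (X j → Fin (numRuns j) → Lab j) ≤ 2 ^ 2 ^ (13 * n) := by
      rw [Fintype.card_fun, hn]
      calc _ ≤ (2 ^ (2 ^ (4 * ((j : ℕ) + 1)) * 2 ^ (8 * ((j : ℕ) + 1)))) ^ 2 ^ ((j : ℕ) + 1) :=
            (Nat.pow_le_pow_left h1 _).trans (Nat.pow_le_pow_right (by positivity) (hX j))
        _ = 2 ^ 2 ^ (13 * ((j : ℕ) + 1)) := by
            rw [← pow_mul, ← pow_add, ← pow_add]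
            exact congrArg (fun a => 2 ^ 2 ^ a) (by ring)
    have h3 : (2 : ℝ) ^ ((2 ^ (13 * n) : ℕ) : ℝ) = ((2 ^ 2 ^ (13 * n) : ℕ) : ℝ) := by
      rw [Real.rpow_natCast, Nat.cast_pow, Nat.cast_ofNat]
    rw [h3]
    exact_mod_cast h2
  have hγ0 : 0 < γ := by rw [hγ]; positivity
  have hγ1 : γ < 1 := by rw [hγ]; exact pow_lt_one₀ (by norm_num) (by norm_num) (by omega)
  have hdc := exists_dense_class
    (tr := fun f x i => tr j x (ρ i) f)
    (BoxLabel.pi fun x => BoxLabel.pi fun i => htr j x (ρ i)) hB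
    (fun t f => (∑ h ∈ Finset.range j, stagePotential tr acc h (s h) f) +
      stagePotential tr acc j (voteOutcome acc j ρ t) f)
    (fun t f => add_nonneg (Finset.sum_nonneg fun h _ => stagePotential_nonneg _ _ _ _ _)
      (stagePotential_nonneg _ _ _ _ _)) hγ0 hγ1 hcard (c := E + 2 * e)
  obtain ⟨t, C, hCB, hCne, hCavg, hCdense⟩ := hdc hρ'
  -- plant the outcome
  obtain ⟨s', hs'⟩ : ∃ s' : ∀ h, X h → Bool, s' = Function.update s j (voteOutcome acc j ρ t) :=
    ⟨_, rfl⟩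
  have hs'lt : ∀ h < (j : ℕ), s' h = s h := fun h hh => by
    rw [hs', Function.update_of_ne hh.ne]
  have hs'j : s' j = voteOutcome acc j ρ t := by rw [hs', Function.update_self]
  have hCavg' : boxAvg C (fun f => ∑ h ∈ Finset.range (j + 1), stagePotential tr acc h (s' h) f) ≤
      (E + 2 * e) / (1 - γ) := by
    refine le_trans (boxAvg_mono C fun f _ => le_of_eq ?_) hCavg
    rw [Finset.sum_range_succ, hs'j]
    exact congrArg (· + _) (Finset.sum_congr rfl fun h hh => by
      rw [hs'lt h (Finset.mem_range.mp hh)])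
  have hCdense' : ∀ p : Fin H × Bool, (j : ℕ) ≤ p.1 →
      (Fintype.card (X p.1 → Bool) : ℝ) ^ Fintype.card (Row p.1) ≤
        (C p).card * (2 : ℝ) ^ ((2 ^ (14 * (n - 1)) + 2 ^ (13 * n) + 6 * n : ℕ) : ℝ) := by
    intro p hp
    have h1 := hdense p hp
    have h2 := hCdense p
    have hj : (j : ℕ) = n - 1 := by omega
    have h3 : ((B p).card : ℝ) ≤ (C p).card * ((2 : ℝ) ^ ((2 ^ (13 * n) : ℕ) : ℝ) * 2 ^ (6 * n)) := by
      have h4 : (0 : ℝ) < (2 : ℝ) ^ ((2 ^ (13 * n) : ℕ) : ℝ) := by positivity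
      have h5 : γ * 2 ^ (6 * n) = 1 := by rw [hγ, ← mul_pow]; norm_num
      calc ((B p).card : ℝ) = (γ / (2 : ℝ) ^ ((2 ^ (13 * n) : ℕ) : ℝ) * (B p).card) *
            ((2 : ℝ) ^ ((2 ^ (13 * n) : ℕ) : ℝ) * 2 ^ (6 * n)) := by
            have aux : ∀ Q b g p : ℝ, Q ≠ 0 → g * p = 1 → b = g / Q * b * (Q * p) := by
              intro Q b g p hQ hg
              calc b = g * p * b := by rw [hg, one_mul]
                _ = _ := by field_simp
            exact aux _ _ _ _ h4.ne' h5
        _ ≤ _ := by gcongr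
    rw [Nat.cast_add, Nat.cast_add, Real.rpow_add two_pos, Real.rpow_add two_pos,
      Real.rpow_natCast 2 (6 * n), ← hj]
    calc _ ≤ ((B p).card : ℝ) * (2 : ℝ) ^ ((2 ^ (14 * (j : ℕ)) : ℕ) : ℝ) := h1
      _ ≤ ((C p).card * ((2 : ℝ) ^ ((2 ^ (13 * n) : ℕ) : ℝ) * 2 ^ (6 * n))) *
          (2 : ℝ) ^ ((2 ^ (14 * (j : ℕ)) : ℕ) : ℝ) := by gcongr
      _ = _ := by ring
  have h14 : (2 : ℕ) ^ (14 * n) = 4 * 2 ^ (14 * n - 2) := by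
    rw [show (4 : ℕ) = 2 ^ 2 by norm_num, ← pow_add]; congr 1; omega
  have h13 : (2 : ℕ) ^ (13 * n) ≤ 2 * 2 ^ (14 * n - 2) := by
    rw [← pow_succ']; exact Nat.pow_le_pow_right two_pos (by omega)
  have hlin : 180 * n ≤ 2 ^ (14 * n) ∧ 6 * n ≤ 2 ^ (14 * n - 2) := by
    have h1 : n < 2 ^ n := Nat.lt_two_pow_self
    constructor
    · calc 180 * n ≤ 2 ^ 8 * 2 ^ n := Nat.mul_le_mul (by norm_num) h1.le
        _ = 2 ^ (8 + n) := (pow_add _ _ _).symm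
        _ ≤ _ := Nat.pow_le_pow_right two_pos (by omega)
    · calc 6 * n ≤ 2 ^ 3 * 2 ^ n := Nat.mul_le_mul (by norm_num) h1.le
        _ = 2 ^ (3 + n) := (pow_add _ _ _).symm
        _ ≤ _ := Nat.pow_le_pow_right two_pos (by omega)
  have hD' : 2 ^ (14 * (n - 1)) + 2 ^ (13 * n) + 6 * n ≤ 2 ^ (14 * n) := by
    have h1 : (2 : ℕ) ^ (14 * (n - 1)) ≤ 2 ^ (14 * n - 2) :=
      Nat.pow_le_pow_right two_pos (by omega)
    omega
  have hδ0 : 0 < δ := by rw [hδ]; positivity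
  have hδ1 : δ ≤ 1 / 16 := by
    rw [hδ]
    calc (1 / 2 : ℝ) ^ (180 * n) ≤ (1 / 2) ^ 4 :=
          pow_le_pow_of_le_one (by norm_num) (by norm_num) (by omega)
      _ = 1 / 16 := by norm_num
  have hδd : 1 ≤ δ * (2 : ℝ) ^ ((180 * n : ℕ) : ℝ) := by
    rw [Real.rpow_natCast, hδ, ← mul_pow]; norm_num
  have hR : 2 * (((2 ^ (14 * (n - 1)) + 2 ^ (13 * n) + 6 * n : ℕ) : ℝ) + ((2 ^ (13 * n) : ℕ) : ℝ) +
      ((180 * n : ℕ) : ℝ)) ≤ Fintype.card (Row j) * δ ^ 6 := by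
    have h1 : 2 * ((2 ^ (14 * (n - 1)) + 2 ^ (13 * n) + 6 * n) + 2 ^ (13 * n) + 180 * n) ≤
        2 ^ (20 * n) := by
      calc _ ≤ 2 ^ 3 * 2 ^ (14 * n) := by omega
        _ = 2 ^ (3 + 14 * n) := (pow_add _ _ _).symm
        _ ≤ _ := Nat.pow_le_pow_right two_pos (by omega)
    have h2 : (2 : ℝ) ^ (20 * n) ≤ Fintype.card (Row j) * δ ^ 6 := by
      have h3 : (2 : ℝ) ^ (20 * n) * 2 ^ (1080 * n) ≤ Fintype.card (Row j) := by
        rw [← pow_add, show 20 * n + 1080 * n = 1100 * n by ring, hn]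
        exact_mod_cast hRow j
      have h4 : (2 : ℝ) ^ (1080 * n) * δ ^ 6 = 1 := by
        rw [hδ, ← pow_mul, show 180 * n * 6 = 1080 * n by ring, ← mul_pow]; norm_num
      calc (2 : ℝ) ^ (20 * n) = (2 : ℝ) ^ (20 * n) * 2 ^ (1080 * n) * δ ^ 6 := by
            rw [mul_assoc, h4, mul_one]
        _ ≤ _ := by gcongr
    refine le_trans ?_ h2
    exact_mod_cast h1
  have hΛ : ∀ w : Σ h : Fin ((j : ℕ) + 1), X h × (Fin (numRuns h) → Ω h),
      (Fintype.card (Fin (numRuns w.1) → Lab w.1) : ℝ) ≤ (2 : ℝ) ^ ((2 ^ (13 * n) : ℕ) : ℝ) := by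
    intro w
    have hw : (w.1 : ℕ) + 1 ≤ n := by have := w.1.2; omega
    have h1 := card_labels_le (hLab w.1) (numRuns_le w.1)
    rw [← pow_add] at h1
    have h2 := h1.trans (Nat.pow_le_pow_right two_pos
      (Nat.pow_le_pow_right two_pos
        (show 4 * ((w.1 : ℕ) + 1) + 8 * ((w.1 : ℕ) + 1) ≤ 13 * n by omega)))
    rw [Real.rpow_natCast]
    exact_mod_cast h2
  have hφ : ∀ f, ∑ h ∈ Finset.range ((j : ℕ) + 1), stagePotential tr acc h (s' h) f = _ := fun f =>
    sum_stagePotential_eq tr acc j s' f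
  simp only [hφ] at hCavg'
  have hCp := Fintype.piFinset_nonempty.mp hCne
  obtain ⟨r', x, y, hx, hy, hxy, havg⟩ := exists_planted
    (W := Σ h : Fin ((j : ℕ) + 1), X h × (Fin (numRuns h) → Ω h))
    (Λ := fun w => Fin (numRuns w.1) → Lab w.1)
    (fun w f i => tr w.1 w.2.1 (w.2.2 i) f)
    (fun w => BoxLabel.pi fun i => htr _ _ _)
    (fun w l => if ∀ i, acc w.1 w.2.1 (w.2.2 i) (l i) ≠ s' w.1 w.2.1 then
          (3 / 2 : ℝ) ^ numRuns w.1 / (Fintype.card (Ω w.1) : ℝ) ^ numRuns w.1 else 0)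
    (fun w => (3 / 2 : ℝ) ^ numRuns w.1 / (Fintype.card (Ω w.1) : ℝ) ^ numRuns w.1)
    (fun w l => by split_ifs <;> positivity)
    (fun w l => by split_ifs <;> [exact le_rfl; positivity])
    hδ0 hδ1 (Nat.cast_nonneg _) (Nat.cast_nonneg _) (Nat.cast_nonneg _) hδd hΛ j hR
    C hCp (fun b => hCdense' (j, b) le_rfl) (s' j)
  have hweights := sum_weights_le (Ω := Ω) hX j
  refine ⟨⟨Function.update (Function.update C (j, false) {x}) (j, true) {y}, s',
    Function.update r j r', ?_, ?_, ?_, ?_⟩⟩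
  · intro p
    by_cases h1 : p = (j, true)
    · subst h1; simp
    · by_cases h2 : p = (j, false)
      · subst h2; simp
      · simpa [h1, h2] using hCp p
  · intro h hh f hf z
    rw [Fintype.mem_piFinset] at hf
    have hft : f (j, true) = y := by simpa using hf (j, true)
    have hff : f (j, false) = x := by simpa using hf (j, false)
    rcases eq_or_ne h j with rfl | hne
    · rw [hft, hff, Function.update_self]
      exact hxy z
    · have hlt : (h : ℕ) < j := lt_of_le_of_ne (Nat.lt_succ_iff.mp hh) fun e => hne (Fin.ext e)
      rw [Function.update_of_ne hlt.ne, hs'lt h hlt]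
      refine henc h hlt f (Fintype.mem_piFinset.mpr fun p => ?_) z
      by_cases h1 : p = (j, true)
      · subst h1; rw [hft]; exact hCB _ hy
      · by_cases h2 : p = (j, false)
        · subst h2; rw [hff]; exact hCB _ hx
        · have := hf p
          rw [Function.update_of_ne h1, Function.update_of_ne h2] at this
          exact hCB p this
  · intro p hp
    have h1 : p ≠ (j, true) := fun h => by subst h; simp at hp
    have h2 : p ≠ (j, false) := fun h => by subst h; simp at hp
    rw [Function.update_of_ne h1, Function.update_of_ne h2]
    refine (hCdense' p (by omega)).trans ?_
    gcongr
    · norm_num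
    · rw [← hn]; exact hD'
  · simp only [hφ]
    refine havg.trans ?_
    have h8 : 8 * δ ≤ e := by
      rw [hδ, he]
      calc 8 * (1 / 2 : ℝ) ^ (180 * n) ≤ 8 * (1 / 2) ^ (3 + 5 * n) := by
            refine mul_le_mul_of_nonneg_left ?_ (by norm_num)
            exact pow_le_pow_of_le_one (by norm_num) (by norm_num) (by omega)
        _ = _ := by rw [pow_add]; ring
    have hb : 8 * δ * (2 : ℝ) ^ (170 * n) ≤ e := by
      have h1 : δ * (2 : ℝ) ^ (170 * n) = (1 / 2) ^ (10 * n) := by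
        rw [hδ, show 180 * n = 10 * n + 170 * n by ring, pow_add, mul_assoc, ← mul_pow]
        norm_num
      rw [mul_assoc, h1, he]
      calc 8 * (1 / 2 : ℝ) ^ (10 * n) ≤ 8 * (1 / 2) ^ (3 + 5 * n) := by
            refine mul_le_mul_of_nonneg_left ?_ (by norm_num)
            exact pow_le_pow_of_le_one (by norm_num) (by norm_num) (by omega)
        _ = _ := by rw [pow_add]; ring
    have hγe : γ ≤ e / 2 := by
      rw [hγ, he]
      calc (1 / 2 : ℝ) ^ (6 * n) ≤ (1 / 2) ^ (5 * n + 1) :=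
            pow_le_pow_of_le_one (by norm_num) (by norm_num) (by omega)
        _ = _ := by rw [pow_succ]; ring
    have hj : (j : ℕ) = n - 1 := by omega
    have key := budget_step hn1 (hj ▸ hpot) he hγe hb h8 (by positivity) hE0
    have hbase : (1 - (1 / 2 : ℝ) ^ n) / 2 = (1 - (1 / 2) ^ ((j : ℕ) + 1)) / 2 := by rw [hn]
    refine le_trans ?_ (key.trans hbase.le)
    have he1 : e ≤ 1 / 2 := by
      rw [he]
      calc (1 / 2 : ℝ) ^ (5 * n) ≤ (1 / 2) ^ 1 :=
            pow_le_pow_of_le_one (by norm_num) (by norm_num) (by omega)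
        _ = 1 / 2 := by norm_num
    refine div_le_div_of_nonneg_right ?_ (by linarith)
    have hbase' : (2 : ℝ) ^ (170 * ((j : ℕ) + 1)) = 2 ^ (170 * n) := by rw [hn]
    have h9 : 8 * δ * _ ≤ 8 * δ * (2 : ℝ) ^ (170 * n) :=
      mul_le_mul_of_nonneg_left (hweights.trans hbase'.le) (by positivity)
    exact add_le_add hCavg' h9

/-- There are tables and one row for each stage such that the bits encoded in these rows are given by
the runs of the stages with probability more than `1/3`, for all stages and inputs at once. -/
theorem exists_encoding (htr : ∀ h x ω, BoxLabel (tr h x ω))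
    (hX : ∀ h, Fintype.card (X h) ≤ 2 ^ (h + 1))
    (hLab : ∀ h, Fintype.card (Lab h) ≤ 2 ^ 2 ^ (4 * (h + 1)))
    (hRow : ∀ h, 2 ^ (1100 * (h + 1)) ≤ Fintype.card (Row h)) :
    ∃ (f : ∀ p : Fin H × Bool, HalfTable Row X p) (r : ∀ h, Row h), ∀ (h : Fin H) (x : X h),
      wrongFrac (fun ω => acc h x ω (tr h x ω f))
        (xor (f (h, false) (r h) x) (f (h, true) (r h) x)) < 2 / 3 := by
  classical
  have hall : ∀ j ≤ H, Nonempty (StageBox tr acc j) := by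
    intro j
    induction j with
    | zero =>
      intro _
      refine ⟨⟨fun _ => Finset.univ, fun _ _ => false, fun _ => Classical.arbitrary _,
        fun _ => ⟨fun _ _ => false, Finset.mem_univ _⟩, fun h hh => absurd hh (Nat.not_lt_zero _),
        fun p _ => ?_, ?_⟩⟩
      · rw [Finset.card_univ, Fintype.card_fun (α := Row p.1), Nat.cast_pow]
        exact le_mul_of_one_le_right (by positivity)
          (Real.one_le_rpow (by norm_num) (Nat.cast_nonneg _))
      · simp [boxAvg]
    | succ j ih =>
      intro hj
      obtain ⟨S⟩ := ih (by omega)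
      exact exists_stageBox_succ tr acc htr hX hLab hRow ⟨j, by omega⟩ S
  obtain ⟨⟨B, s, r, hBne, henc, -, hpot⟩⟩ := hall H le_rfl
  have hB : (Fintype.piFinset B).Nonempty := Fintype.piFinset_nonempty.mpr hBne
  have hlt : ∃ f ∈ Fintype.piFinset B,
      ∑ h ∈ Finset.range H, stagePotential tr acc h (s h) f < 1 := by
    by_contra! h
    have h1 := boxAvg_mono B h
    rw [boxAvg_const hB] at h1
    have : (0 : ℝ) ≤ (1 / 2) ^ H := by positivity
    linarith
  obtain ⟨f, hf, hlt⟩ := hlt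
  refine ⟨f, r, fun h x => ?_⟩
  rw [henc h h.2 f hf x]
  refine wrongFrac_lt_of_stagePotential_lt_one tr acc (lt_of_le_of_lt ?_ hlt) x
  exact Finset.single_le_sum (f := fun h => stagePotential tr acc h (s h) f)
    (fun h _ => stagePotential_nonneg _ _ _ _ _) (Finset.mem_range.mpr h.2)

end Stages

/-! ### Queries to a multilinear extension -/

section Queries

theorem RawQuery.parse_bounds {q : List Bool} {Q : RawQuery} (h : RawQuery.parse q = some Q) :
    Q.m ≤ q.length ∧ Q.k * Nat.size Q.p ≤ q.length := by
  simp only [RawQuery.parse, RawQuery.ofParts] at h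
  split_ifs at h with hc
  obtain ⟨hw, hl⟩ := hc
  simp only [Option.some.injEq] at h
  subst h
  simp only at hw ⊢
  constructor
  · refine (List.takeWhile_prefix _).length_le.trans ?_
    simp only [List.length_drop]
    omega
  · rw [hw]
    refine le_trans (Nat.mul_le_mul_right _ (Nat.le_add_right _ _)) (hl.symm.le.trans ?_)
    simp only [List.length_drop]
    omega

theorem RawQuery.length_encodeElement (Q : RawQuery) (v : AdjoinRoot Q.poly) :
    (Q.encodeElement v).length = Q.k * Nat.size Q.p :=
  length_flatten_ofFn _ fun _ => length_bitsOfNat _ _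

theorem RawQuery.natDegree_poly (Q : RawQuery) [Nontrivial (ZMod Q.p)] :
    Q.poly.natDegree = Q.k := by
  rw [RawQuery.poly]
  refine Polynomial.natDegree_eq_of_degree_eq_some ?_
  rw [add_comm]
  rw [Polynomial.degree_add_eq_right_of_degree_lt, Polynomial.degree_X_pow]
  rw [Polynomial.degree_X_pow]
  exact Polynomial.degree_sum_fin_lt _

/-- Elements of the field of a query are determined by the strings that encode them. -/
theorem RawQuery.encodeElement_injective (Q : RawQuery) (hp : Q.p.Prime) :
    Function.Injective Q.encodeElement := by
  intro v v' h
  have : Fact Q.p.Prime := ⟨hp⟩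
  have hlen : ∀ u : AdjoinRoot Q.poly, ∀ i : Fin Q.k, (bitsOfNat (Nat.size Q.p)
    ((AdjoinRoot.modByMonicHom Q.poly_monic u).coeff i).val).length = Nat.size Q.p :=
    fun u i => length_bitsOfNat _ _
  have hcoeff : ∀ i : Fin Q.k, (AdjoinRoot.modByMonicHom Q.poly_monic v).coeff i =
      (AdjoinRoot.modByMonicHom Q.poly_monic v').coeff i := by
    intro i
    have h1 := block_flatten _ (hlen v) [] i
    have h2 := block_flatten _ (hlen v') [] i
    rw [List.append_nil] at h1 h2
    have h3 : bitsOfNat (Nat.size Q.p) ((AdjoinRoot.modByMonicHom Q.poly_monic v).coeff i).val =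
        bitsOfNat (Nat.size Q.p) ((AdjoinRoot.modByMonicHom Q.poly_monic v').coeff i).val := by
      rw [← h1, ← h2]
      exact congrArg (fun l => (l.drop (i * Nat.size Q.p)).take (Nat.size Q.p)) h
    have hlt : ∀ a : ZMod Q.p, a.val < 2 ^ Nat.size Q.p := fun a =>
      (ZMod.val_lt a).trans (Nat.lt_size_self _)
    have h4 := congrArg natOfBits h3
    rw [natOfBits_bitsOfNat _ _ (hlt _), natOfBits_bitsOfNat _ _ (hlt _)] at h4
    exact ZMod.val_injective _ h4
  have hpoly : AdjoinRoot.modByMonicHom Q.poly_monic v =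
      AdjoinRoot.modByMonicHom Q.poly_monic v' := by
    ext i
    by_cases hi : i < Q.k
    · exact hcoeff ⟨i, hi⟩
    · have hdeg : ∀ u : AdjoinRoot Q.poly,
          (AdjoinRoot.modByMonicHom Q.poly_monic u).coeff i = 0 := by
        intro u
        obtain ⟨g, rfl⟩ := AdjoinRoot.mk_surjective u
        rw [AdjoinRoot.modByMonicHom_mk]
        refine Polynomial.coeff_eq_zero_of_degree_lt ?_
        refine (Polynomial.degree_modByMonic_lt _ Q.poly_monic).trans_le ?_
        rw [Polynomial.degree_eq_natDegree Q.poly_monic.ne_zero, Q.natDegree_poly]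
        exact_mod_cast not_lt.mp hi
      rw [hdeg, hdeg]
  rw [← AdjoinRoot.mk_leftInverse Q.poly_monic v, hpoly, AdjoinRoot.mk_leftInverse]

/-- The answer to a query depends only on the table of the length that it names. -/
theorem Oracle.multilinear_congr {A A' : Oracle} {q : List Bool}
    (h : ∀ m ≤ q.length, A m = A' m) : A.multilinear q = A'.multilinear q := by
  unfold Oracle.multilinear
  split
  · rfl
  · rename_i Q hQ
    have := h Q.m (RawQuery.parse_bounds hQ).1
    simp only [RawQuery.value, multilinearExt, this]

theorem Oracle.length_multilinear_le (A : Oracle) (q : List Bool) :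
    (A.multilinear q).length ≤ q.length := by
  unfold Oracle.multilinear
  split
  · simp
  · rename_i Q hQ
    split_ifs
    · rw [RawQuery.length_encodeElement]
      exact (RawQuery.parse_bounds hQ).2
    · simp

/-- The bit number `i` of a point of the cube, `false` if there is none. -/
def bitAt {m : ℕ} (b : Fin m → Bool) (i : ℕ) : Bool := if h : i < m then b ⟨i, h⟩ else false

/-- The part of an oracle on the strings with first bit `β`. -/
def Oracle.side (A : Oracle) (β : Bool) : Oracle := fun _ b => A _ b && (bitAt b 0 == β)

/-- The multilinear extension is linear in the table, so it is the sum of the extensions of the two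
sides. -/
theorem multilinearExt_side (A : Oracle) (m : ℕ) (K : Type*) [CommRing K] (x : Fin m → K) :
    multilinearExt A m K x =
      multilinearExt (A.side false) m K x + multilinearExt (A.side true) m K x := by
  unfold multilinearExt multilinearPoly
  rw [← map_add, ← Finset.sum_add_distrib]
  refine congrArg _ (Finset.sum_congr rfl fun b _ => ?_)
  simp only [Oracle.side]
  by_cases hA : A m b = true <;> by_cases hb : bitAt b 0 = true <;> simp [hA, hb]

/-- The answers of the two sides determine the answer of the oracle. -/
theorem Oracle.multilinear_eq_of_side_eq {A A' : Oracle} {q : List Bool}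
    (h : ∀ β, (A.side β).multilinear q = (A'.side β).multilinear q) :
    A.multilinear q = A'.multilinear q := by
  unfold Oracle.multilinear at h ⊢
  split
  · rfl
  · rename_i Q hQ
    simp only [hQ] at h
    split_ifs at h ⊢ with hc
    · have hv : ∀ β, Q.value (A.side β) = Q.value (A'.side β) := fun β =>
        Q.encodeElement_injective hc.1 (h β)
      unfold RawQuery.value at hv ⊢
      rw [multilinearExt_side, hv, hv, ← multilinearExt_side]
    · rfl

end Queries

/-! ### Runs of oracle machines -/

namespace OracleTM

variable (M : OracleTM)

theorem run_append (O : StringOracle) (x r r' : List Bool) :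
    M.run O x (r ++ r') = r'.foldl (M.step O) (M.run O x r) := List.foldl_append

theorem length_query_step_le (O : StringOracle) (c : M.Cfg) (b : Bool) :
    (M.step O c b).query.length ≤ c.query.length + 1 := by
  unfold step
  split
  · omega
  · simp only
    split <;> simp

theorem length_query_run_le (O : StringOracle) (x r : List Bool) :
    (M.run O x r).query.length ≤ r.length := by
  induction r using List.reverseRecOn with
  | nil => simp [run, init]
  | append_singleton r b ih =>
    rw [run_append, List.foldl_cons, List.foldl_nil]
    refine (M.length_query_step_le O _ b).trans ?_
    simpa using ih

theorem step_congr {O O' : StringOracle} {c : M.Cfg} (b : Bool) (h : O c.query = O' c.query) :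
    M.step O c b = M.step O' c b := by
  unfold step
  split
  · rfl
  · simp only [h]

/-- Two runs agree as long as the current queries are answered alike. -/
theorem run_congr {O O' : StringOracle} {x r : List Bool}
    (h : ∀ t < r.length, M.run O x (r.take t) = M.run O' x (r.take t) →
      O (M.run O x (r.take t)).query = O' (M.run O x (r.take t)).query) {t : ℕ}
    (ht : t ≤ r.length) : M.run O x (r.take t) = M.run O' x (r.take t) := by
  induction t with
  | zero => rfl
  | succ t ih =>
    have ih' := ih (by omega)
    rw [List.take_add_one, List.getElem?_eq_getElem (by omega), run_append, run_append]
    simp only [Option.toList_some, List.foldl_cons, List.foldl_nil]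
    rw [M.step_congr _ (h t (by omega) ih'), ih']

theorem run_congr_of_eq {A A' : Oracle} {x r : List Bool} (h : ∀ m ≤ r.length, A m = A' m) :
    M.run A.multilinear x r = M.run A'.multilinear x r := by
  have := M.run_congr (O := A.multilinear) (O' := A'.multilinear) (x := x) (r := r)
    (fun t ht _ => Oracle.multilinear_congr fun m hm => h m (hm.trans
      ((M.length_query_run_le _ _ _).trans (by simp)))) le_rfl
  rwa [List.take_length] at this

/-- The transcript of a run with the multilinear extension of `A`: in every step, the answers of the two
sides of `A` to the query written so far, padded to `T` symbols. -/
noncomputable def transcript (x : List Bool) {T : ℕ} (r : Fin T → Bool) (A : Oracle) :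
    Fin T → Bool → Fin T → Option Bool :=
  fun t β i => ((A.side β).multilinear (M.run A.multilinear x ((List.ofFn r).take t)).query)[(i : ℕ)]?

variable {M}

theorem side_eq_of_transcript_eq {x : List Bool} {T : ℕ} {r : Fin T → Bool} {A A' : Oracle}
    (h : M.transcript x r A = M.transcript x r A') {t : ℕ} (ht : t < T) (β : Bool) :
    (A.side β).multilinear (M.run A.multilinear x ((List.ofFn r).take t)).query =
      (A'.side β).multilinear (M.run A'.multilinear x ((List.ofFn r).take t)).query := by
  have hlen : ∀ B : Oracle, ((B.side β).multilinear
      (M.run B.multilinear x ((List.ofFn r).take t)).query).length ≤ T := by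
    intro B
    refine ((B.side β).length_multilinear_le _).trans ((M.length_query_run_le _ _ _).trans ?_)
    simp only [List.length_take, List.length_ofFn]
    omega
  refine List.ext_getElem? fun i => ?_
  by_cases hi : i < T
  · exact congrFun (congrFun (congrFun h ⟨t, ht⟩) β) ⟨i, hi⟩
  · rw [List.getElem?_eq_none ((hlen A).trans (not_lt.mp hi)),
      List.getElem?_eq_none ((hlen A').trans (not_lt.mp hi))]

theorem run_eq_of_transcript_eq {x : List Bool} {T : ℕ} {r : Fin T → Bool} {A A' : Oracle}
    (h : M.transcript x r A = M.transcript x r A') {t : ℕ} (ht : t ≤ T) :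
    M.run A.multilinear x ((List.ofFn r).take t) =
      M.run A'.multilinear x ((List.ofFn r).take t) := by
  refine M.run_congr (fun t ht heq => ?_) (by simpa using ht)
  rw [List.length_ofFn] at ht
  refine Oracle.multilinear_eq_of_side_eq fun β => ?_
  have := side_eq_of_transcript_eq h ht β
  rwa [← heq] at this

/-- If each side of `B` answers every query like `A` or like `A'`, and these two have the same transcript,
then `B` has this transcript, too. -/
theorem transcript_eq_of_mixed {x : List Bool} {T : ℕ} {r : Fin T → Bool} {A A' B : Oracle}
    (h : M.transcript x r A = M.transcript x r A')
    (hB : ∀ β q, (B.side β).multilinear q = (A.side β).multilinear q ∨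
      (B.side β).multilinear q = (A'.side β).multilinear q) :
    M.transcript x r B = M.transcript x r A := by
  have hside : ∀ t < T, ∀ β,
      (B.side β).multilinear (M.run A.multilinear x ((List.ofFn r).take t)).query =
        (A.side β).multilinear (M.run A.multilinear x ((List.ofFn r).take t)).query := by
    intro t ht β
    rcases hB β (M.run A.multilinear x ((List.ofFn r).take t)).query with e | e
    · exact e
    · rw [e]
      have h1 := side_eq_of_transcript_eq h ht β
      rw [← run_eq_of_transcript_eq h ht.le] at h1
      exact h1.symm
  have hrun : ∀ t ≤ T, M.run A.multilinear x ((List.ofFn r).take t) =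
      M.run B.multilinear x ((List.ofFn r).take t) := by
    intro t ht
    refine M.run_congr (fun t ht _ => ?_) (by simpa using ht)
    rw [List.length_ofFn] at ht
    exact Oracle.multilinear_eq_of_side_eq fun β => (hside t ht β).symm
  funext t β i
  simp only [transcript]
  rw [← hrun t t.2.le, hside t t.2]

end OracleTM

/-! ### Tables as oracles -/

section Tables

/-- The bit that an oracle assigns to a string. -/
def Oracle.read (A : Oracle) (q : List Bool) : Bool := A q.length q.get

theorem bitAt_get (q : List Bool) (i : ℕ) : bitAt q.get i = q.getD i false := by
  unfold bitAt
  split_ifs with h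
  · simp [List.getD_eq_getElem?_getD, h]
  · simp [List.getD_eq_getElem?_getD, not_lt.mp h]

variable (inp : ℕ → ℕ)

/-- The length of the row addresses of stage `h`.  It compensates for the length of the inputs, so that
different stages use strings of different lengths. -/
def rowLength (h : ℕ) : ℕ := 1101 * (h + 1) - inp h

/-- The row addresses of stage `h`. -/
abbrev RowAddress (h : ℕ) : Type := Fin (rowLength inp h) → Bool

/-- The inputs of stage `h`. -/
abbrev StageInput (h : ℕ) : Type := Fin (inp h) → Bool

/-- The length of the strings on which an oracle stores the half-tables of stage `h`. -/
def tableLength (h : ℕ) : ℕ := 1 + rowLength inp h + inp h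

variable {inp}

theorem tableLength_injective (hinp : ∀ h, inp h ≤ h + 1) : Function.Injective (tableLength inp) := by
  intro h h' e
  have h1 := hinp h
  have h2 := hinp h'
  unfold tableLength rowLength at e
  omega

/-- The string that consists of a side, a row address and an input. -/
def address (β : Bool) {h : ℕ} (r : RowAddress inp h) (x : StageInput inp h) : List Bool :=
  β :: (List.ofFn r ++ List.ofFn x)

theorem length_address (β : Bool) {h : ℕ} (r : RowAddress inp h) (x : StageInput inp h) :
    (address β r x).length = tableLength inp h := by
  simp only [address, tableLength, List.length_cons, List.length_append, List.length_ofFn]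
  omega

variable {H : ℕ}

open Classical in
/-- The oracle that stores the half-tables of the first `H` stages, each stage on strings of its own
length, the two halves being told apart by the first bit. -/
noncomputable def tableOracle (f : ∀ p : Fin H × Bool, HalfTable (RowAddress inp) (StageInput inp) p) :
    Oracle := fun m b =>
  if hm : ∃ h : Fin H, tableLength inp h = m then
    f (hm.choose, bitAt b 0) (fun i => bitAt b (1 + i))
      (fun i => bitAt b (1 + rowLength inp hm.choose + i))
  else false

theorem tableOracle_apply (hinp : ∀ h, inp h ≤ h + 1)
    (f : ∀ p : Fin H × Bool, HalfTable (RowAddress inp) (StageInput inp) p) {m : ℕ} {h : Fin H}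
    (hm : tableLength inp h = m) (b : Fin m → Bool) :
    tableOracle f m b = f (h, bitAt b 0) (fun i => bitAt b (1 + i))
      (fun i => bitAt b (1 + rowLength inp h + i)) := by
  have hex : ∃ h : Fin H, tableLength inp h = m := ⟨h, hm⟩
  have hh : hex.choose = h :=
    Fin.ext (tableLength_injective hinp (hex.choose_spec.trans hm.symm))
  unfold tableOracle
  rw [dif_pos hex]
  generalize hex.choose = h' at hh
  subst hh
  rfl

theorem read_tableOracle_address (hinp : ∀ h, inp h ≤ h + 1)
    (f : ∀ p : Fin H × Bool, HalfTable (RowAddress inp) (StageInput inp) p) (h : Fin H) (β : Bool)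
    (r : RowAddress inp h) (x : StageInput inp h) :
    (tableOracle f).read (address β r x) = f (h, β) r x := by
  unfold Oracle.read
  rw [tableOracle_apply hinp f (length_address β r x).symm]
  have h0 : bitAt (address β r x).get 0 = β := bitAt_get _ _
  have h1 : (fun i : Fin (rowLength inp h) => bitAt (address β r x).get (1 + i)) = r := by
    funext i
    rw [bitAt_get, address, Nat.add_comm 1 i, List.getD_cons_succ,
      List.getD_append _ _ _ _ (by simp)]
    simp [List.getD_eq_getElem?_getD]
  have h2 : (fun i : Fin (inp h) => bitAt (address β r x).get (1 + rowLength inp h + i)) = x := by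
    funext i
    rw [bitAt_get, address, Nat.add_assoc, Nat.add_comm 1 _, List.getD_cons_succ,
      List.getD_append_right _ _ _ _ (by simp)]
    simp [List.getD_eq_getElem?_getD]
  rw [h1, h2, h0]

/-- Each side of a mixture of tables answers a query like one of the two tables, since a query concerns
one length only. -/
theorem multilinear_side_piecewise (hinp : ∀ h, inp h ≤ h + 1)
    (f g : ∀ p : Fin H × Bool, HalfTable (RowAddress inp) (StageInput inp) p)
    (S : Finset (Fin H × Bool)) (β : Bool) (q : List Bool) :
    ((tableOracle (S.piecewise f g)).side β).multilinear q =
        ((tableOracle f).side β).multilinear q ∨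
      ((tableOracle (S.piecewise f g)).side β).multilinear q =
        ((tableOracle g).side β).multilinear q := by
  have key : ∀ m, ((tableOracle (S.piecewise f g)).side β) m = ((tableOracle f).side β) m ∨
      ((tableOracle (S.piecewise f g)).side β) m = ((tableOracle g).side β) m := by
    intro m
    by_cases hm : ∃ h : Fin H, tableLength inp h = m
    · obtain ⟨h, hm⟩ := hm
      by_cases hS : (h, β) ∈ S
      · left
        funext b
        simp only [Oracle.side, tableOracle_apply hinp _ hm]
        by_cases hb : bitAt b 0 = β
        · rw [hb, Finset.piecewise_eq_of_mem _ _ _ hS]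
        · rw [beq_false_of_ne hb, Bool.and_false, Bool.and_false]
      · right
        funext b
        simp only [Oracle.side, tableOracle_apply hinp _ hm]
        by_cases hb : bitAt b 0 = β
        · rw [hb, Finset.piecewise_eq_of_notMem _ _ _ hS]
        · rw [beq_false_of_ne hb, Bool.and_false, Bool.and_false]
    · left
      funext b
      simp only [Oracle.side, tableOracle, dif_neg hm]
  unfold Oracle.multilinear
  split
  · exact Or.inl rfl
  · rename_i Q hQ
    rcases key Q.m with e | e
    · left
      simp only [RawQuery.value, multilinearExt, e]
    · right
      simp only [RawQuery.value, multilinearExt, e]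

/-- The transcript of a run is a label whose classes are boxes in the space of all half-tables. -/
theorem boxLabel_transcript (hinp : ∀ h, inp h ≤ h + 1) (M : OracleTM) (x : List Bool) {T : ℕ}
    (r : Fin T → Bool) :
    BoxLabel fun f : ∀ p : Fin H × Bool, HalfTable (RowAddress inp) (StageInput inp) p =>
      M.transcript x r (tableOracle f) := fun f g S hfg =>
  OracleTM.transcript_eq_of_mixed hfg fun β q => multilinear_side_piecewise hinp f g S β q

end Tables

/-! ### Oracles that encode the outcomes of all stages -/

section Stages

/-- Whether `M` has accepted `x` when the coins `ω` are used up. -/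
noncomputable def OracleTM.accepts (M : OracleTM) (A : Oracle) {n : ℕ} (x : Fin n → Bool) {T : ℕ}
    (ω : Fin T → Bool) : Bool :=
  open Classical in
  decide ((M.run A.multilinear (List.ofFn x) (List.ofFn ω)).state = Sum.inr true)

/-- The oracle `A` encodes stage `h`: the exclusive or of some two rows with the same address in the
two half-tables is the verdict of the machine of the stage, for every input of the stage and more than
a third of the coins. -/
def EncodesStage (Mach : ℕ → OracleTM) (inp time : ℕ → ℕ) (A : Oracle) (h : ℕ) : Prop :=
  ∃ r : RowAddress inp h, ∀ x : StageInput inp h,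
    wrongFrac (fun ω : Fin (time h) → Bool => (Mach h).accepts A x ω)
      (xor (A.read (address false r x)) (A.read (address true r x))) < 2 / 3

variable {Mach : ℕ → OracleTM} {inp time : ℕ → ℕ}

theorem EncodesStage.congr {A A' : Oracle} {h : ℕ}
    (hA : ∀ m ≤ max (time h) (tableLength inp h), A m = A' m)
    (hh : EncodesStage Mach inp time A h) : EncodesStage Mach inp time A' h := by
  obtain ⟨r, hr⟩ := hh
  refine ⟨r, fun x => ?_⟩
  have h1 : ∀ β, A'.read (address β r x) = A.read (address β r x) := by
    intro β
    unfold Oracle.read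
    rw [hA _ (by rw [length_address]; exact le_max_right _ _)]
  have h2 : ∀ ω : Fin (time h) → Bool, (Mach h).accepts A' x ω = (Mach h).accepts A x ω := by
    intro ω
    unfold OracleTM.accepts
    rw [OracleTM.run_congr_of_eq _ fun m hm =>
      (hA m (hm.trans (by rw [List.length_ofFn]; exact le_max_left _ _))).symm]
  simpa only [h1, h2] using hr x

theorem card_transcripts_le {T h : ℕ} (hT : T ≤ 2 ^ (h + 1)) :
    Fintype.card (Fin T → Bool → Fin T → Option Bool) ≤ 2 ^ 2 ^ (4 * (h + 1)) := by
  have hc : Fintype.card (Fin T → Bool → Fin T → Option Bool) = ((3 ^ T) ^ 2) ^ T := by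
    simp [Fintype.card_pi, Fintype.card_option]
  rw [hc]
  calc ((3 ^ T) ^ 2) ^ T ≤ (((2 ^ 2) ^ T) ^ 2) ^ T := by gcongr; norm_num
    _ = 2 ^ (4 * T * T) := by rw [← pow_mul, ← pow_mul, ← pow_mul]; ring_nf
    _ ≤ 2 ^ 2 ^ (4 * (h + 1)) := by
        refine Nat.pow_le_pow_right (by norm_num) ?_
        calc 4 * T * T ≤ 4 * 2 ^ (h + 1) * 2 ^ (h + 1) := by gcongr
          _ = 2 ^ (2 + (h + 1) + (h + 1)) := by rw [pow_add _ (2 + (h + 1)), pow_add _ 2]; norm_num only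
          _ ≤ 2 ^ (4 * (h + 1)) := Nat.pow_le_pow_right (by norm_num) (by omega)

theorem exists_encodesStage_lt (hinp : ∀ h, inp h ≤ h + 1) (htime : ∀ h, time h ≤ 2 ^ (h + 1)) (H : ℕ) :
    ∃ A : Oracle, ∀ h < H, EncodesStage Mach inp time A h := by
  classical
  let tr : ∀ h, StageInput inp h → (Fin (time h) → Bool) →
      (∀ p : Fin H × Bool, HalfTable (RowAddress inp) (StageInput inp) p) →
      (Fin (time h) → Bool → Fin (time h) → Option Bool) :=
    fun h x ω f => (Mach h).transcript (List.ofFn x) ω (tableOracle f)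
  -- the verdict is a function of the transcript
  let acc : ∀ h, StageInput inp h → (Fin (time h) → Bool) →
      (Fin (time h) → Bool → Fin (time h) → Option Bool) → Bool :=
    fun h x ω l => decide (∃ f, tr h x ω f = l ∧ (Mach h).accepts (tableOracle f) x ω = true)
  have hacc : ∀ h x ω f, acc h x ω (tr h x ω f) = (Mach h).accepts (tableOracle f) x ω := by
    intro h x ω f
    by_cases hf : (Mach h).accepts (tableOracle f) x ω = true
    · rw [hf]
      exact decide_eq_true ⟨f, rfl, hf⟩
    · rw [Bool.not_eq_true] at hf
      rw [hf]
      refine decide_eq_false ?_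
      rintro ⟨g, hg, hg'⟩
      have := OracleTM.run_eq_of_transcript_eq hg le_rfl
      rw [List.take_of_length_le (by simp)] at this
      unfold OracleTM.accepts at hf hg'
      rw [this] at hg'
      simp [hg'] at hf
  obtain ⟨f, r, hfr⟩ := exists_encoding tr acc
    (fun h x ω => boxLabel_transcript hinp _ _ _)
    (fun h => by
      rw [Fintype.card_fun, Fintype.card_bool, Fintype.card_fin]
      exact Nat.pow_le_pow_right (by norm_num) (hinp h))
    (fun h => card_transcripts_le (htime h))
    (fun h => by
      rw [Fintype.card_fun, Fintype.card_bool, Fintype.card_fin]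
      refine Nat.pow_le_pow_right (by norm_num) ?_
      have := hinp h
      unfold rowLength
      omega)
  refine ⟨tableOracle f, fun h hh => ⟨r h, fun x => ?_⟩⟩
  have := hfr ⟨h, hh⟩ x
  simp only [hacc] at this
  have hread : ∀ β, (tableOracle f).read (address β (r h) x) = f (⟨h, hh⟩, β) (r h) x :=
    fun β => read_tableOracle_address hinp f ⟨h, hh⟩ β (r h) x
  rw [hread, hread]
  exact this

/-- A limit of oracles for finitely many stages encodes all stages, as each stage looks at finitely many
lengths only. -/
theorem exists_encodesStage (Mach : ℕ → OracleTM) (hinp : ∀ h, inp h ≤ h + 1)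
    (htime : ∀ h, time h ≤ 2 ^ (h + 1)) :
    ∃ A : Oracle, ∀ h, EncodesStage Mach inp time A h := by
  classical
  choose B hB using exists_encodesStage_lt (Mach := Mach) hinp htime
  let A : Oracle := fun m b => decide (∀ᶠ H in (Filter.hyperfilter ℕ : Filter ℕ), B H m b = true)
  have hA : ∀ m, ∀ᶠ H in (Filter.hyperfilter ℕ : Filter ℕ), B H m = A m := by
    intro m
    have : ∀ b, ∀ᶠ H in (Filter.hyperfilter ℕ : Filter ℕ), B H m b = A m b := by
      intro b
      by_cases hb : ∀ᶠ H in (Filter.hyperfilter ℕ : Filter ℕ), B H m b = true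
      · filter_upwards [hb] with H hH
        rw [hH]
        exact (decide_eq_true hb).symm
      · filter_upwards [Ultrafilter.eventually_not.mpr hb] with H hH
        rw [Bool.not_eq_true] at hH
        rw [hH]
        exact (decide_eq_false hb).symm
    filter_upwards [Filter.eventually_all.mpr this] with H hH
    exact funext hH
  refine ⟨A, fun h => ?_⟩
  have h1 : ∀ᶠ H in (Filter.hyperfilter ℕ : Filter ℕ),
      ∀ m ∈ Finset.range (max (time h) (tableLength inp h) + 1), B H m = A m :=
    (Filter.eventually_all_finset _).mpr fun m _ => hA m
  have h2 : ∀ᶠ H in (Filter.hyperfilter ℕ : Filter ℕ), h < H :=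
    Nat.hyperfilter_le_atTop (Filter.eventually_gt_atTop h)
  obtain ⟨H, hH1, hH2⟩ := (h1.and h2).exists
  exact (hB H h hH2).congr fun m hm => hH1 m (Finset.mem_range.mpr (by omega))

end Stages

/-! ### Circuits that compare two answers of an oracle -/

section Circuits

variable {n : ℕ}

/-- A query whose symbols are inputs or constants, with the inputs filled in. -/
def fillIn (x : Fin n → Bool) (l : List (Fin n ⊕ Bool)) : List Bool := l.map (Sum.elim x id)

/-- The wire that carries an input or a constant, in a circuit with the two constants as first gates. -/
def sourceWire : Fin n ⊕ Bool → Fin (n + 2)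
  | .inl i => i.castSucc.castSucc
  | .inr false => (Fin.last n).castSucc
  | .inr true => Fin.last (n + 1)

/-- The circuit for the exclusive or of bit number `0` of the answers to two queries. -/
def xorCircuit (l₀ l₁ : List (Fin n ⊕ Bool)) : Circuit n where
  numWires := n + 8
  gates := .snoc (.snoc (.snoc (.snoc (.snoc (.snoc (.snoc (.snoc .nil
    (.const false)) (.const true)) (.oracle (l₀.map sourceWire) 0))
    (.oracle (l₁.map fun a => (sourceWire a).castSucc) 0))
    (.or (Fin.last _).castSucc (Fin.last _)))
    (.and (Fin.last _).castSucc.castSucc (Fin.last _).castSucc))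
    (.not (Fin.last _)))
    (.and (Fin.last _).castSucc.castSucc (Fin.last _))
  output := Fin.last _

theorem size_xorCircuit (l₀ l₁ : List (Fin n ⊕ Bool)) :
    (xorCircuit l₀ l₁).size = l₀.length + l₁.length + 15 := by
  simp only [xorCircuit, Circuit.size, GateSeq.size, Gate.fanIn, List.length_map]
  ring

theorem eval_xorCircuit (l₀ l₁ : List (Fin n ⊕ Bool)) (O : StringOracle) (x : Fin n → Bool) :
    (xorCircuit l₀ l₁).eval O x =
      xor ((O (fillIn x l₀)).getD 0 false) ((O (fillIn x l₁)).getD 0 false) := by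
  let v : Fin (n + 2) → Bool := GateSeq.eval O x (.snoc (.snoc .nil (.const false)) (.const true))
  have hv : ∀ a, v (sourceWire a) = Sum.elim x id a := by
    rintro (i | b | b) <;> simp [v, sourceWire, GateSeq.eval, Gate.eval]
  have h0 : (l₀.map sourceWire).map v = fillIn x l₀ := by
    simp only [List.map_map, fillIn]
    exact List.map_congr_left fun a _ => hv a
  have h1 : ∀ b : Bool, (l₁.map fun a => (sourceWire a).castSucc).map
      (Fin.snoc (α := fun _ => Bool) v b) = fillIn x l₁ := by
    intro b
    simp only [List.map_map, fillIn]
    refine List.map_congr_left fun a _ => ?_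
    simp only [Function.comp, Fin.snoc_castSucc]
    exact hv a
  simp only [Circuit.eval, xorCircuit]
  rw [GateSeq.eval, GateSeq.eval, GateSeq.eval, GateSeq.eval, GateSeq.eval, GateSeq.eval]
  change Fin.snoc (α := fun _ => Bool) (Fin.snoc (α := fun _ => Bool)
    (Fin.snoc (α := fun _ => Bool) (Fin.snoc (α := fun _ => Bool)
    (Fin.snoc (α := fun _ => Bool) (Fin.snoc (α := fun _ => Bool) v _) _) _) _) _) _ (Fin.last _) = _
  simp only [Gate.eval, Fin.snoc_last, Fin.snoc_castSucc]
  have hxor : ∀ a b : Bool, ((a || b) && !(a && b)) = xor a b := by decide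
  rw [← h0, ← h1 ((O ((l₀.map sourceWire).map v)).getD 0 false)]
  exact hxor _ _

end Circuits

/-! ### Points of the cube as queries over the field with two elements -/

section CubeQueries

/-- The query that names the field with two elements and a point of the cube. -/
def cubeRawQuery (q : List Bool) : RawQuery where
  p := 2
  k := 1
  m := q.length
  f := fun _ => 0
  x := fun j _ => (q.get j).toNat

/-- The string for this query, with symbols in a type that has two constants. -/
def cubeQuery {α : Type*} (c : Bool → α) (q : List α) : List α :=
  [true, true, false, false, true, true, false].map c ++ (List.replicate q.length (c true) ++
    ([false, false, false].map c ++ q.flatMap fun a => [a, c false]))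

theorem length_cubeQuery {α : Type*} (c : Bool → α) (q : List α) :
    (cubeQuery c q).length = 3 * q.length + 10 := by
  simp [cubeQuery]
  ring

theorem map_cubeQuery {α β : Type*} (c : Bool → α) (g : α → β) (q : List α) :
    (cubeQuery c q).map g = cubeQuery (g ∘ c) (q.map g) := by
  simp [cubeQuery, List.map_flatMap, List.flatMap_map]

theorem encode_cubeRawQuery (q : List Bool) : (cubeRawQuery q).encode = cubeQuery id q := by
  have hs : Nat.size 2 = 2 := by decide
  have hb : ∀ b : Bool, bitsOfNat 2 b.toNat = [b, false] := by decide
  have h0 : bitsOfNat 2 2 = [false, true] := by decide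
  have h1 : bitsOfNat 2 0 = [false, false] := by decide
  have hx : (List.ofFn fun j : Fin q.length =>
      (List.ofFn fun _ : Fin 1 => bitsOfNat 2 (q.get j).toNat).flatten) =
      q.map fun a => [a, false] := by
    conv_rhs => rw [← List.ofFn_get q, List.map_ofFn]
    congr 1
    funext j
    simp [hb]
  simp only [RawQuery.encode, cubeRawQuery, hs]
  rw [hx, h0]
  simp [cubeQuery, h1, List.flatMap]

theorem poly_cubeRawQuery (q : List Bool) : (cubeRawQuery q).poly = Polynomial.X := by
  have hsum : ∀ g : Fin 1 → Polynomial (ZMod 2), ∑ i, g i = g 0 := Fin.sum_univ_one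
  have h := hsum fun i => Polynomial.C ((0 : ℕ) : ZMod 2) * Polynomial.X ^ (i : ℕ)
  have h' : (Polynomial.X ^ 1 + ∑ i : Fin 1, Polynomial.C ((0 : ℕ) : ZMod 2) *
      Polynomial.X ^ (i : ℕ) : Polynomial (ZMod 2)) = Polynomial.X := by
    rw [h]
    simp
  exact h'

/-- The multilinear extension tells the values of the oracle. -/
theorem multilinear_cubeQuery (A : Oracle) (q : List Bool) :
    (A.multilinear (cubeQuery id q)).getD 0 false = A.read q := by
  have hs : Nat.size 2 = 2 := by decide
  have hparse : RawQuery.parse (cubeQuery id q) = some (cubeRawQuery q) := by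
    rw [← encode_cubeRawQuery]
    refine RawQuery.parse_encode _ (fun _ => by positivity) fun j i => ?_
    have : (q.get j).toNat ≤ 1 := Bool.toNat_le _
    simp only [cubeRawQuery, hs]
    omega
  have hirr : Irreducible (cubeRawQuery q).poly := by
    rw [poly_cubeRawQuery]
    have : Fact (cubeRawQuery q).p.Prime := ⟨Nat.prime_two⟩
    exact Polynomial.irreducible_X
  have hprime : (cubeRawQuery q).p.Prime := Nat.prime_two
  have : Fact (cubeRawQuery q).p.Prime := ⟨hprime⟩
  have hpoint : (cubeRawQuery q).point = fun j => if q.get j then 1 else 0 := by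
    funext j
    have hsum : ∀ g : Fin 1 → Polynomial (ZMod 2), ∑ i, g i = g 0 := Fin.sum_univ_one
    have h := hsum fun i => Polynomial.C ((q.get j).toNat : ZMod 2) * Polynomial.X ^ (i : ℕ)
    refine (congrArg (AdjoinRoot.mk (cubeRawQuery q).poly) h).trans ?_
    cases q.get j
    · refine Eq.trans (congrArg _ ?_) (map_zero (AdjoinRoot.mk (cubeRawQuery q).poly))
      change (Polynomial.C ((false.toNat : ℕ) : ZMod 2) * Polynomial.X ^ 0 : Polynomial (ZMod 2)) = 0
      simp
    · refine Eq.trans (congrArg _ ?_) (map_one (AdjoinRoot.mk (cubeRawQuery q).poly))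
      change (Polynomial.C ((true.toNat : ℕ) : ZMod 2) * Polynomial.X ^ 0 : Polynomial (ZMod 2)) = 1
      simp
  have hvalue : (cubeRawQuery q).value A = if A.read q then 1 else 0 := by
    rw [RawQuery.value, hpoint]
    exact multilinearExt_bool A _ _ q.get
  unfold Oracle.multilinear
  rw [hparse]
  simp only
  rw [if_pos ⟨hprime, hirr⟩, hvalue]
  have hhom : ∀ b : Bool, (AdjoinRoot.modByMonicHom (cubeRawQuery q).poly_monic
      (if b then 1 else 0)) = if b then 1 else 0 := by
    intro b
    cases b
    · simp
    · simp only [if_true]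
      rw [← map_one (AdjoinRoot.mk _), AdjoinRoot.modByMonicHom_mk,
        (Polynomial.modByMonic_eq_self_iff (RawQuery.poly_monic _)).mpr]
      rw [poly_cubeRawQuery]
      simp
  unfold RawQuery.encodeElement
  simp only [hhom]
  have hflat : ∀ g : Fin 1 → List Bool, (List.ofFn g).flatten = g 0 := fun g => by simp
  refine (congrArg (fun l : List Bool => l.getD 0 false) (hflat _)).trans ?_
  have hdigit : ∀ b : Bool, (bitsOfNat (Nat.size 2)
      (ZMod.val ((if b then 1 else 0 : Polynomial (ZMod 2)).coeff 0))).getD 0 false = b := by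
    intro b
    cases b
    · rw [if_neg (by simp), Polynomial.coeff_zero, ZMod.val_zero, hs]
      decide
    · rw [if_pos rfl, Polynomial.coeff_one_zero, ZMod.val_one, hs]
      decide
  exact hdigit _

end CubeQueries

/-! ### The schedule of the stages -/

section Schedule

instance : Finite Turing.Dir :=
  Finite.of_injective (fun d : Turing.Dir => decide (d = Turing.Dir.left)) (by
    intro a b; cases a <;> cases b <;> simp)

instance : Finite OracleOp :=
  Finite.of_injective (β := Option (Option Bool))
    (fun | .idle => none | .ask => some none | .push b => some (some b)) (by
    intro a b; cases a <;> cases b <;> simp)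

instance (s t : ℕ) : Finite (TMAction s t) :=
  Finite.of_injective (fun a : TMAction s t => (a.next, a.write, a.move, a.op)) (by
    rintro ⟨_, _, _, _⟩ ⟨_, _, _, _⟩ h
    simpa using h)

instance : Countable OracleTM :=
  Function.Injective.countable (β := Σ s : ℕ, Σ w : ℕ, Fin s × (Fin s → (Fin (w + 2) → Option Bool) →
      Bool → TMAction s (w + 2)))
    (f := fun M => ⟨M.numStates, M.numWork, M.start, M.trans⟩) (by
    rintro ⟨_, _, _, _⟩ ⟨_, _, _, _⟩ h
    simp only [Sigma.mk.injEq] at h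
    obtain ⟨rfl, h⟩ := h
    rw [heq_eq_eq, Sigma.mk.injEq] at h
    obtain ⟨rfl, h⟩ := h
    rw [heq_eq_eq, Prod.mk.injEq] at h
    obtain ⟨rfl, rfl⟩ := h
    rfl)

instance : Nonempty OracleTM :=
  ⟨⟨1, 0, 0, fun _ _ _ => ⟨Sum.inr true, fun _ => none, fun _ => none, .idle⟩⟩⟩

/-- Stage `h` with `h + 1 = 2 ^ i * (2 * n + 1)` treats the inputs of length `n` for the machine and the
clock with number `i`. -/
def stageNumber (h : ℕ) : ℕ := padicValNat 2 (h + 1)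

/-- The length of the inputs that stage `h` treats. -/
def stageInputLength (h : ℕ) : ℕ := (h + 1) / 2 ^ stageNumber h / 2

/-- The running time that stage `h` grants to its machine. -/
def stageTime (h : ℕ) : ℕ :=
  2 ^ ((stageNumber h).unpair.2 * stageInputLength h + (stageNumber h).unpair.2)

theorem stageInputLength_le (h : ℕ) : stageInputLength h ≤ h + 1 :=
  (Nat.div_le_self _ _).trans (Nat.div_le_self _ _)

theorem stageTime_le (h : ℕ) : stageTime h ≤ 2 ^ (h + 1) := by
  refine Nat.pow_le_pow_right (by norm_num) ?_
  set i := stageNumber h with hi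
  have hdvd : 2 ^ i ∣ h + 1 := pow_padicValNat_dvd
  obtain ⟨q, hq⟩ := hdvd
  have hn : stageInputLength h = q / 2 := by
    rw [stageInputLength, ← hi, hq, Nat.mul_div_cancel_left _ (by positivity)]
  have hq0 : 1 ≤ q := by
    rcases Nat.eq_zero_or_pos q with h0 | h0
    · rw [h0, mul_zero] at hq
      omega
    · exact h0
  rw [hn, hq]
  calc i.unpair.2 * (q / 2) + i.unpair.2 = i.unpair.2 * (q / 2 + 1) := by ring
    _ ≤ 2 ^ i * q := Nat.mul_le_mul ((Nat.unpair_right_le i).trans Nat.lt_two_pow_self.le) (by omega)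

theorem stageNumber_eq {h i n : ℕ} (hh : h + 1 = 2 ^ i * (2 * n + 1)) : stageNumber h = i := by
  have : Fact (Nat.Prime 2) := ⟨Nat.prime_two⟩
  rw [stageNumber, hh, padicValNat.mul (by positivity) (by positivity), padicValNat.prime_pow,
    padicValNat.eq_zero_of_not_dvd (by omega), add_zero]

theorem stageInputLength_eq {h i n : ℕ} (hh : h + 1 = 2 ^ i * (2 * n + 1)) :
    stageInputLength h = n := by
  rw [stageInputLength, stageNumber_eq hh, hh, Nat.mul_div_cancel_left _ (by positivity)]
  omega

end Schedule

/-! ### Languages from encoded stages -/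

section Languages

/-- A verdict that is right for more than a third of the coins is the right one. -/
theorem eq_true_iff_of_wrongFrac_lt {M : OracleTM} {A : Oracle} {T : ℕ → ℕ} {L : Language Bool}
    (hM : M.DecidesBP A.multilinear T L) {n : ℕ} (x : Fin n → Bool) {s : Bool}
    (hs : wrongFrac (fun ω : Fin (T n) → Bool => M.accepts A x ω) s < 2 / 3) :
    s = true ↔ List.ofFn x ∈ L := by
  classical
  obtain ⟨-, hyes, hno⟩ := hM (List.ofFn x)
  rw [List.length_ofFn] at hyes hno
  have hfalse : wrongFrac (fun ω : Fin (T n) → Bool => M.accepts A x ω) false =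
      (M.acceptProb A.multilinear (List.ofFn x) (T n) : ℝ) := by
    unfold wrongFrac OracleTM.acceptProb OracleTM.accepts
    simp only [ne_eq, Bool.not_eq_false, decide_eq_true_eq, Fintype.card_fun, Fintype.card_bool,
      Fintype.card_fin]
    push_cast
    congr!
  have hadd : wrongFrac (fun ω : Fin (T n) → Bool => M.accepts A x ω) true +
      wrongFrac (fun ω : Fin (T n) → Bool => M.accepts A x ω) false = 1 := by
    unfold wrongFrac
    rw [← add_div, ← Nat.cast_add, div_eq_one_iff_eq (by positivity), Nat.cast_inj]
    have := Finset.card_filter_add_card_filter_not (s := Finset.univ)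
      (fun ω : Fin (T n) → Bool => M.accepts A x ω ≠ true)
    simpa using this
  by_cases hx : List.ofFn x ∈ L
  · have h1 : ((2 / 3 : ℚ) : ℝ) ≤ _ := Rat.cast_le.mpr (hyes hx)
    push_cast at h1
    cases s
    · linarith
    · simp [hx]
  · have h1 : _ ≤ ((1 / 3 : ℚ) : ℝ) := Rat.cast_le.mpr (hno hx)
    push_cast at h1
    cases s
    · simp [hx]
    · linarith

/-- The address of a row entry, with the input left open. -/
def addressTemplate (β : Bool) {n m : ℕ} (r : Fin m → Bool) : List (Fin n ⊕ Bool) :=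
  Sum.inr β :: (List.ofFn (fun i => Sum.inr (r i)) ++ List.ofFn Sum.inl)

/-- There is an oracle relative to which every language in `BPE` is the exclusive or of two oracle bits,
at addresses of linear length that consist of input bits and constants. -/
theorem exists_oracle_xor : ∃ A : Oracle, ∀ L ∈ BPE A.multilinear, ∃ k : ℕ, ∀ n,
    ∃ l₀ l₁ : List (Fin n ⊕ Bool), l₀.length ≤ k * n + k ∧ l₁.length ≤ k * n + k ∧
      ∀ x, xor (A.read (fillIn x l₀)) (A.read (fillIn x l₁)) = true ↔ List.ofFn x ∈ L := by
  obtain ⟨e, he⟩ := exists_surjective_nat OracleTM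
  obtain ⟨A, hA⟩ := exists_encodesStage (fun h => e (stageNumber h).unpair.1) stageInputLength_le
    stageTime_le
  refine ⟨A, ?_⟩
  rintro L ⟨M, c, hM⟩
  obtain ⟨j, rfl⟩ := he M
  set i := Nat.pair j c with hi
  refine ⟨2202 * 2 ^ i + 1, fun n => ?_⟩
  obtain ⟨h, hh⟩ : ∃ h, h + 1 = 2 ^ i * (2 * n + 1) :=
    ⟨2 ^ i * (2 * n + 1) - 1, Nat.sub_add_cancel (Nat.succ_le_of_lt (by positivity))⟩
  obtain ⟨r, hr⟩ := hA h
  have hnum : stageNumber h = i := stageNumber_eq hh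
  have hn : stageInputLength h = n := stageInputLength_eq hh
  have htime : stageTime h = 2 ^ (c * n + c) := by
    rw [stageTime, hnum, hn, hi, Nat.unpair_pair]
  have hlen : ∀ β, (addressTemplate β r : List (Fin n ⊕ Bool)).length ≤
      (2202 * 2 ^ i + 1) * n + (2202 * 2 ^ i + 1) := by
    intro β
    have h1 : rowLength stageInputLength h + n = 1101 * (2 ^ i * (2 * n + 1)) := by
      rw [← hh, rowLength, hn]
      have := stageInputLength_le h
      omega
    have h2 : (addressTemplate β r : List (Fin n ⊕ Bool)).length =
        rowLength stageInputLength h + n + 1 := by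
      simp [addressTemplate]
    rw [h2, h1]
    nlinarith [Nat.zero_le (2 ^ i), Nat.zero_le n]
  refine ⟨addressTemplate false r, addressTemplate true r, hlen _, hlen _, ?_⟩
  simp only [hnum, hi, Nat.unpair_pair] at hr
  clear_value i
  subst hn
  rw [htime] at hr
  intro x
  have hfill : ∀ β, fillIn x (addressTemplate β r) = address β r x := by
    intro β
    simp [fillIn, addressTemplate, address, List.map_ofFn, Function.comp_def]
  rw [hfill, hfill]
  exact eq_true_iff_of_wrongFrac_lt hM x (hr x)

theorem linearSize_subset_pPoly (O : StringOracle) : LinearSize O ⊆ PPoly O := by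
  rintro L ⟨c, hc⟩
  refine ⟨2 * c + 2, fun n => ?_⟩
  obtain ⟨C, hC, hCL⟩ := hc n
  refine ⟨C, hC.trans (?_ : c * n + c ≤ n ^ (2 * c + 2) + (2 * c + 2)), hCL⟩
  rcases Nat.lt_or_ge n 2 with hn | hn
  · have : c * n ≤ c * 1 := Nat.mul_le_mul_left c (by omega)
    omega
  · calc c * n + c = c * (n + 1) := by ring
      _ ≤ n ^ c * n ^ 2 := Nat.mul_le_mul
          (Nat.lt_two_pow_self.le.trans (Nat.pow_le_pow_left hn c)) (by nlinarith)
      _ = n ^ (c + 2) := (pow_add _ _ _).symm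
      _ ≤ n ^ (2 * c + 2) := Nat.pow_le_pow_right (by omega) (by omega)
      _ ≤ n ^ (2 * c + 2) + (2 * c + 2) := Nat.le_add_right _ _

end Languages

theorem theorem3 :
    (∃ A : Oracle, BPE A.multilinear ⊆ LinearSize A.boolean) ∧
      ¬ SeparationAlgebrizes BPE PPoly ∧
      ¬ SeparationAffineRelativizes BPE PPoly := by
  obtain ⟨A, hA⟩ := exists_oracle_xor
  have hbool : BPE A.multilinear ⊆ LinearSize A.boolean := by
    intro L hL
    obtain ⟨k, hk⟩ := hA L hL
    refine ⟨2 * k + 15, fun n => ?_⟩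
    obtain ⟨l₀, l₁, h0, h1, hx⟩ := hk n
    refine ⟨xorCircuit l₀ l₁, ?_, fun x => ?_⟩
    · rw [size_xorCircuit]
      nlinarith
    · rw [eval_xorCircuit]
      exact hx x
  have hmult : BPE A.multilinear ⊆ LinearSize A.multilinear := by
    intro L hL
    obtain ⟨k, hk⟩ := hA L hL
    refine ⟨6 * k + 35, fun n => ?_⟩
    obtain ⟨l₀, l₁, h0, h1, hx⟩ := hk n
    refine ⟨xorCircuit (cubeQuery Sum.inr l₀) (cubeQuery Sum.inr l₁), ?_, fun x => ?_⟩
    · rw [size_xorCircuit, length_cubeQuery, length_cubeQuery]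
      nlinarith
    · have hfill : ∀ l : List (Fin n ⊕ Bool),
          fillIn x (cubeQuery Sum.inr l) = cubeQuery id (fillIn x l) := by
        intro l
        exact map_cubeQuery _ _ _
      rw [eval_xorCircuit, hfill, hfill, multilinear_cubeQuery, multilinear_cubeQuery]
      exact hx x
  exact ⟨⟨A, hbool⟩, fun h => h A (hbool.trans (linearSize_subset_pPoly _)),
    fun h => h A (hmult.trans (linearSize_subset_pPoly _))⟩
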